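/- A bicolored graph is a finite graph, multiple edges allowed, whose vertices are colored black or white, in which every edge joins a black and a white vertex and no vertex is isolated. A map is a bicolored graph drawn on a (possibly disconnected) closed surface so that every connected component of the complement (a face) is an open disc. An oriented map is a map on an oriented surface; combinatorially, an oriented map with edges labeled by $[n]=\{1,\dots,n\}$ is a pair of permutations $(\sigma_1,\sigma_2)$ of $[n]$ whose cycles give the counterclockwise cyclic orders of the edges around the white, respectively black, vertices; it is connected when $\langle\sigma_1,\sigma_2\rangle$ is transitive. A non-oriented map is a map on an arbitrary surface without additional structure; combinatorially, a non-oriented map with labeled edge-sides is a triple $(\mathcal B,\mathcal W,\mathcal E)$ of pairings of the same set of edge-sides (two sides for each edge), where $\mathcal B$, $\mathcal W$ pair the edge-sides sharing a corner at a black, respectively white, vertex and $\mathcal E$ pairs the two sides of each edge. A rooted oriented map has one decorated edge; a rooted non-oriented map has one decorated edge-side. Unlabeled maps and graphs are considered up to isomorphism preserving the colors of the vertices, the root (for rooted maps) and, for oriented maps, the orientation. For a non-oriented map $M$, viewed as a ribbon graph, remove all its edges one after another in a uniformly random order, each vertex that becomes isolated being removed as well. Let $\mathrm{mon}^{\mathrm{top}}_M$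 be the probability that at each step (from $M$ itself to the empty map) the number of faces of the ribbon graph is equal to the number of its connected components. **Theorem.** For all integers $n\ge 1$ the following formal linear combinations of (unlabeled) bicolored graphs are equal: $$\sum_{M_1=(G_1,S_1)} G_1=\sum_{M_2=(G_2,S_2)}\mathrm{mon}^{\mathrm{top}}_{M_2}\,G_2 ,$$ where the sum on the left-hand side runs over the oriented, unlabeled, rooted, connected maps $M_1$ with $n$ edges (with any number of faces), the sum on the right-hand side runs over the non-oriented, unlabeled, rooted maps $M_2$ with $n$ edges and exactly one face, and $G_i$ denotes the underlying bicolored graph of $M_i=(G_i,S_i)$, a map drawn on the surface $S_i$. -/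

import Mathlib

/-! Combinatorial bicolored maps, oriented and non-oriented, and their underlying graphs. -/

/-- A bicolored graph: every edge has one black and one white extremity, multiple edges are allowed,
isolated vertices are not. -/
structure BicoloredGraph : Type 1 where
  Black : Type
  White : Type
  Edge : Type
  blackEnd : Edge → Black
  whiteEnd : Edge → White
  black_not_isolated : Function.Surjective blackEnd
  white_not_isolated : Function.Surjective whiteEnd

namespace BicoloredGraph

/-- Color-preserving isomorphism of bicolored graphs. -/
def Isomorphic (G H : BicoloredGraph) : Prop :=
  ∃ (b : G.Black ≃ H.Black) (w : G.White ≃ H.White) (e : G.Edge ≃ H.Edge),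
    (∀ x, H.blackEnd (e x) = b (G.blackEnd x)) ∧ (∀ x, H.whiteEnd (e x) = w (G.whiteEnd x))

theorem isomorphic_equivalence : Equivalence Isomorphic where
  refl _ := ⟨Equiv.refl _, Equiv.refl _, Equiv.refl _, fun _ => rfl, fun _ => rfl⟩
  symm := by
    rintro G H ⟨b, w, e, hb, hw⟩
    refine ⟨b.symm, w.symm, e.symm, fun x => ?_, fun x => ?_⟩
    · rw [Equiv.eq_symm_apply, ← hb, Equiv.apply_symm_apply]
    · rw [Equiv.eq_symm_apply, ← hw, Equiv.apply_symm_apply]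
  trans := by
    rintro G H K ⟨b, w, e, hb, hw⟩ ⟨b₁, w₁, e₁, hb₁, hw₁⟩
    exact ⟨b.trans b₁, w.trans w₁, e.trans e₁, fun x => by simp [hb, hb₁],
      fun x => by simp [hw, hw₁]⟩

instance isoSetoid : Setoid BicoloredGraph := ⟨Isomorphic, isomorphic_equivalence⟩

end BicoloredGraph

/-- Unlabeled bicolored graphs: isomorphism classes of bicolored graphs. -/
abbrev UnlabeledGraph : Type 1 := Quotient BicoloredGraph.isoSetoid

/-! ### Oriented maps -/

/-- An oriented map whose edges are labeled by the elements of `X`. The cycles of `white`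
(respectively `black`) are the counterclockwise cyclic orders of the edges around the white
(respectively black) vertices. -/
@[ext]
structure OrientedMap (X : Type) where
  white : Equiv.Perm X
  black : Equiv.Perm X

namespace OrientedMap

variable {X : Type}

/-- The underlying bicolored graph; the vertices are the cycles (including fixed points). -/
def graph (M : OrientedMap X) : BicoloredGraph where
  Black := Quotient (Equiv.Perm.SameCycle.setoid M.black)
  White := Quotient (Equiv.Perm.SameCycle.setoid M.white)
  Edge := X
  blackEnd := Quotient.mk _
  whiteEnd := Quotient.mk _
  black_not_isolated := Quotient.mk_surjective
  white_not_isolated := Quotient.mk_surjective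

/-- Connectedness: the group generated by the two permutations is transitive. -/
def IsConnected (M : OrientedMap X) : Prop :=
  MulAction.IsPretransitive (Subgroup.closure {M.white, M.black} : Subgroup (Equiv.Perm X)) X

/-- `f` is a relabeling of the edges that turns `M` into `N`. -/
structure IsIso (f : X ≃ X) (M N : OrientedMap X) : Prop where
  white : ∀ x, N.white (f x) = f (M.white x)
  black : ∀ x, N.black (f x) = f (M.black x)

theorem IsIso.graph_isomorphic {f : X ≃ X} {M N : OrientedMap X} (h : IsIso f M N) :
    M.graph.Isomorphic N.graph := by
  have key : ∀ σ τ : Equiv.Perm X, (∀ x, τ (f x) = f (σ x)) →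
      ∀ x y, σ.SameCycle x y ↔ τ.SameCycle (f x) (f y) := by
    intro σ τ hst x y
    have e : τ = f * σ * f⁻¹ := by
      ext z
      have := hst (f⁻¹ z)
      simpa using this
    subst e
    rw [Equiv.Perm.sameCycle_conj]
    simp
  exact ⟨Quotient.congr f (key _ _ h.black), Quotient.congr f (key _ _ h.white), f,
    fun _ => rfl, fun _ => rfl⟩

end OrientedMap

/-- Labeled rooted connected oriented maps with `n` edges: one edge is decorated. -/
structure LabeledRootedOrientedMap (n : ℕ) where
  map : OrientedMap (Fin n)
  root : Fin n
  connected : map.IsConnected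

namespace LabeledRootedOrientedMap

variable {n : ℕ}

instance : Finite (LabeledRootedOrientedMap n) :=
  Finite.of_injective (fun M => (M.map.white, M.map.black, M.root)) (by
    rintro ⟨⟨a, b⟩, r, _⟩ ⟨⟨a₁, b₁⟩, r₁, _⟩ h
    simp only [Prod.mk.injEq] at h
    obtain ⟨rfl, rfl, rfl⟩ := h
    rfl)

/-- Two labeled rooted maps differ only by the labels of the edges. -/
instance relabelSetoid (n : ℕ) : Setoid (LabeledRootedOrientedMap n) where
  r M N := ∃ f : Fin n ≃ Fin n, OrientedMap.IsIso f M.map N.map ∧ f M.root = N.root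
  iseqv :=
    { refl := fun _ => ⟨Equiv.refl _, ⟨fun _ => rfl, fun _ => rfl⟩, rfl⟩
      symm := by
        rintro M N ⟨f, ⟨hw, hb⟩, hr⟩
        refine ⟨f.symm, ⟨fun x => ?_, fun x => ?_⟩, ?_⟩
        · rw [Equiv.eq_symm_apply, ← hw, Equiv.apply_symm_apply]
        · rw [Equiv.eq_symm_apply, ← hb, Equiv.apply_symm_apply]
        · rw [← hr, Equiv.symm_apply_apply]
      trans := by
        rintro M N K ⟨f, ⟨hw, hb⟩, hr⟩ ⟨g, ⟨hw₁, hb₁⟩, hr₁⟩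
        exact ⟨f.trans g, ⟨fun x => by simp [hw, hw₁], fun x => by simp [hb, hb₁]⟩,
          by simp [hr, hr₁]⟩ }

end LabeledRootedOrientedMap

/-- Oriented, unlabeled, rooted, connected maps with `n` edges (and any number of faces). -/
abbrev RootedOrientedMap (n : ℕ) : Type :=
  Quotient (LabeledRootedOrientedMap.relabelSetoid n)

namespace RootedOrientedMap

noncomputable instance (n : ℕ) : Fintype (RootedOrientedMap n) := Fintype.ofFinite _

/-- The underlying bicolored graph. -/
def graph {n : ℕ} (M : RootedOrientedMap n) : UnlabeledGraph :=
  Quotient.map (fun M : LabeledRootedOrientedMap n => M.map.graph)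
    (by rintro _ _ ⟨_, h, _⟩; exact h.graph_isomorphic) M

end RootedOrientedMap

/-! ### Non-oriented maps -/

/-- A non-oriented map: three pairings (black corners, white corners, edges) of the same base set,
which is a subset of `X`; the elements of the base set are the edge-sides. A pairing of the base set
is encoded as the involution of `X` that exchanges the two elements of each pair and whose fixed
points are exactly the elements of `X` outside the base set. -/
@[ext]
structure NonOrientedMap (X : Type) where
  black : X → X
  white : X → X
  edge : X → X
  black_involutive : Function.Involutive black
  white_involutive : Function.Involutive white
  edge_involutive : Function.Involutive edge
  black_eq_self_iff : ∀ x, black x = x ↔ edge x = x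
  white_eq_self_iff : ∀ x, white x = x ↔ edge x = x

namespace NonOrientedMap

variable {X : Type}

/-- The base set: the set of edge-sides. -/
def sides (M : NonOrientedMap X) : Set X := {x | M.edge x ≠ x}

/-- The edges: edge-sides up to the pairing `edge`. (`Quot r` is the quotient by the equivalence
relation generated by `r`.) -/
def Edge (M : NonOrientedMap X) : Type :=
  Quot (fun x y : M.sides => (y : X) = M.edge x)

/-- The black vertices: gluing the two sides of each edge identifies their black extremities. -/
def BlackVertex (M : NonOrientedMap X) : Type :=
  Quot (fun x y : M.sides => (y : X) = M.black x ∨ (y : X) = M.edge x)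

/-- The white vertices. -/
def WhiteVertex (M : NonOrientedMap X) : Type :=
  Quot (fun x y : M.sides => (y : X) = M.white x ∨ (y : X) = M.edge x)

/-- The faces: the polygons formed by the edge-sides, two consecutive edge-sides of a polygon being
paired by `black` or by `white`. -/
def Face (M : NonOrientedMap X) : Type :=
  Quot (fun x y : M.sides => (y : X) = M.black x ∨ (y : X) = M.white x)

/-- The connected components. -/
def Component (M : NonOrientedMap X) : Type :=
  Quot (fun x y : M.sides => (y : X) = M.black x ∨ (y : X) = M.white x ∨ (y : X) = M.edge x)

/-- The underlying bicolored graph. -/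
def graph (M : NonOrientedMap X) : BicoloredGraph where
  Black := M.BlackVertex
  White := M.WhiteVertex
  Edge := M.Edge
  blackEnd := Quot.map id fun _ _ h => Or.inr h
  whiteEnd := Quot.map id fun _ _ h => Or.inr h
  black_not_isolated := by rintro ⟨x⟩; exact ⟨Quot.mk _ x, rfl⟩
  white_not_isolated := by rintro ⟨x⟩; exact ⟨Quot.mk _ x, rfl⟩

/-- The corners of a ribbon graph after removal of the ribbon with sides `a` and `e a`: if the
ribbon removed separated the corners `{x, a}` and `{e a, y}`, then these corners are merged into one
corner `{x, y}`. If `f a = e a`, the vertex is a leaf and disappears. -/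
noncomputable def mergeCorners (e f : X → X) (a : X) : X → X :=
  open Classical in
  fun x => if x = a ∨ x = e a then x else if f x = a ∨ f x = e a then f (e (f x)) else f x

theorem mergeCorners_involutive {e f : X → X} (he : Function.Involutive e)
    (hf : Function.Involutive f) (hfix : ∀ x, f x = x ↔ e x = x) (a : X) :
    Function.Involutive (mergeCorners e f a) := by
  intro x
  have h1 := he a
  have h2 := hf x
  have h3 := hf a
  have h4 := hf (e a)
  have h5 := hfix a
  have h6 := hfix (e a)
  unfold mergeCorners
  grind

theorem mergeCorners_eq_self_iff {e f : X → X} (he : Function.Involutive e)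
    (hf : Function.Involutive f) (hfix : ∀ x, f x = x ↔ e x = x) (a x : X) :
    mergeCorners e f a x = x ↔ (x = a ∨ x = e a ∨ e x = x) := by
  have h1 := he a
  have h2 := hf x
  have h3 := hf a
  have h4 := hf (e a)
  have h5 := hfix a
  have h6 := hfix (e a)
  have h7 := hfix x
  unfold mergeCorners
  grind

/-- The map `M` with the edge `{a, M.edge a}` removed from the ribbon graph (isolated vertices are
removed as well). The base set becomes `M.sides` without `a` and `M.edge a`. -/
noncomputable def removeEdge (M : NonOrientedMap X) (a : X) : NonOrientedMap X where
  black := mergeCorners M.edge M.black a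
  white := mergeCorners M.edge M.white a
  edge := open Classical in fun x => if x = a ∨ x = M.edge a then x else M.edge x
  black_involutive :=
    mergeCorners_involutive M.edge_involutive M.black_involutive M.black_eq_self_iff a
  white_involutive :=
    mergeCorners_involutive M.edge_involutive M.white_involutive M.white_eq_self_iff a
  edge_involutive := by
    intro x
    have h1 := M.edge_involutive x
    have h2 := M.edge_involutive a
    grind
  black_eq_self_iff x := by
    rw [mergeCorners_eq_self_iff M.edge_involutive M.black_involutive M.black_eq_self_iff]
    grind
  white_eq_self_iff x := by
    rw [mergeCorners_eq_self_iff M.edge_involutive M.white_involutive M.white_eq_self_iff]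
    grind

/-- The removal of an edge does not depend on the choice of one of its two sides. -/
theorem removeEdge_edge (M : NonOrientedMap X) (a : X) :
    M.removeEdge (M.edge a) = M.removeEdge a := by
  have h1 := M.edge_involutive a
  ext x <;> simp only [removeEdge, mergeCorners, h1] <;> grind

/-- The map obtained by removing one after another the edges given by a list of edge-sides. -/
noncomputable def removeEdges (M : NonOrientedMap X) (l : List X) : NonOrientedMap X :=
  l.foldl removeEdge M

/-- The number of faces is equal to the number of connected components. -/
def IsTopDegree (M : NonOrientedMap X) : Prop := Nat.card M.Face = Nat.card M.Component

/-- A history: a linear order on the set of edges, given as the list of all edges in this order. -/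
def History (M : NonOrientedMap X) : Type := {l : List M.Edge // l.Nodup ∧ ∀ e, e ∈ l}

/-- One of the two sides of an edge. -/
noncomputable def Edge.side {M : NonOrientedMap X} (e : M.Edge) : X := (Quot.out e : M.sides)

/-- The map obtained from `M` by removing the first `i` edges of the history `h`. -/
noncomputable def History.stage {M : NonOrientedMap X} (h : M.History) (i : ℕ) : NonOrientedMap X :=
  M.removeEdges ((h.1.take i).map Edge.side)

/-- At each step of the edge removal the number of faces is the number of connected components. -/
def History.IsTopDegree {M : NonOrientedMap X} (h : M.History) : Prop :=
  ∀ i ≤ h.1.length, (h.stage i).IsTopDegree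

/-- The probability that a uniformly random history of `M` is top-degree. -/
noncomputable def monTop (M : NonOrientedMap X) : ℚ :=
  (Nat.card {h : M.History // h.IsTopDegree} : ℚ) / (Nat.card M.History : ℚ)

/-- `f` is a relabeling of the edge-sides that turns `M` into `N`. -/
structure IsIso (f : X ≃ X) (M N : NonOrientedMap X) : Prop where
  black : ∀ x, N.black (f x) = f (M.black x)
  white : ∀ x, N.white (f x) = f (M.white x)
  edge : ∀ x, N.edge (f x) = f (M.edge x)

namespace IsIso

variable {f : X ≃ X} {M N : NonOrientedMap X}

theorem refl (M : NonOrientedMap X) : IsIso (Equiv.refl X) M M :=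
  ⟨fun _ => rfl, fun _ => rfl, fun _ => rfl⟩

theorem symm (h : IsIso f M N) : IsIso f.symm N M := by
  refine ⟨fun x => ?_, fun x => ?_, fun x => ?_⟩
  · rw [Equiv.eq_symm_apply, ← h.black, Equiv.apply_symm_apply]
  · rw [Equiv.eq_symm_apply, ← h.white, Equiv.apply_symm_apply]
  · rw [Equiv.eq_symm_apply, ← h.edge, Equiv.apply_symm_apply]

theorem trans {g : X ≃ X} {K : NonOrientedMap X} (h : IsIso f M N) (k : IsIso g N K) :
    IsIso (f.trans g) M K :=
  ⟨fun x => by simp [h.black, k.black], fun x => by simp [h.white, k.white],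
    fun x => by simp [h.edge, k.edge]⟩

theorem mem_sides (h : IsIso f M N) (x : X) : x ∈ M.sides ↔ f x ∈ N.sides := by
  simp [sides, h.edge]

/-- The induced bijection of the base sets. -/
def sidesEquiv (h : IsIso f M N) : M.sides ≃ N.sides := f.subtypeEquiv h.mem_sides

/-- The induced bijection of the edges. -/
def edgeEquiv (h : IsIso f M N) : M.Edge ≃ N.Edge :=
  Quot.congr h.sidesEquiv fun x y => by simp [sidesEquiv, h.edge]

/-- The induced bijection of the faces. -/
def faceEquiv (h : IsIso f M N) : M.Face ≃ N.Face :=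
  Quot.congr h.sidesEquiv fun x y => by simp [sidesEquiv, h.black, h.white]

/-- The induced bijection of the connected components. -/
def componentEquiv (h : IsIso f M N) : M.Component ≃ N.Component :=
  Quot.congr h.sidesEquiv fun x y => by simp [sidesEquiv, h.black, h.white, h.edge]

theorem graph_isomorphic (h : IsIso f M N) : M.graph.Isomorphic N.graph := by
  refine ⟨Quot.congr h.sidesEquiv fun x y => by simp [sidesEquiv, h.black, h.edge],
    Quot.congr h.sidesEquiv fun x y => by simp [sidesEquiv, h.white, h.edge], h.edgeEquiv, ?_, ?_⟩
  · rintro ⟨x⟩; rfl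
  · rintro ⟨x⟩; rfl

theorem isTopDegree_iff (h : IsIso f M N) : M.IsTopDegree ↔ N.IsTopDegree := by
  unfold IsTopDegree
  rw [Nat.card_congr h.faceEquiv, Nat.card_congr h.componentEquiv]

theorem removeEdge (h : IsIso f M N) (a : X) :
    IsIso f (M.removeEdge a) (N.removeEdge (f a)) := by
  have key : ∀ x y, f x = f y ↔ x = y := fun x y => f.apply_eq_iff_eq
  refine ⟨fun x => ?_, fun x => ?_, fun x => ?_⟩
  · have h1 := h.black x
    have h2 := h.black (M.edge (M.black x))
    have h3 := h.edge (M.black x)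
    have h4 := h.edge a
    simp only [NonOrientedMap.removeEdge, mergeCorners]
    grind
  · have h1 := h.white x
    have h2 := h.white (M.edge (M.white x))
    have h3 := h.edge (M.white x)
    have h4 := h.edge a
    simp only [NonOrientedMap.removeEdge, mergeCorners]
    grind
  · have h1 := h.edge x
    have h4 := h.edge a
    simp only [NonOrientedMap.removeEdge]
    grind

theorem removeEdges (h : IsIso f M N) (l : List X) :
    IsIso f (M.removeEdges l) (N.removeEdges (l.map f)) := by
  induction l generalizing M N with
  | nil => exact h
  | cons a l ih => exact ih (h.removeEdge a)

end IsIso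

/-- Removing something that is not an edge-side has no effect. -/
theorem removeEdge_of_fixed (M : NonOrientedMap X) {a : X} (ha : M.edge a = a) :
    M.removeEdge a = M := by
  have hb := (M.black_eq_self_iff a).2 ha
  have hw := (M.white_eq_self_iff a).2 ha
  ext x
  · have := M.black_involutive x
    simp only [removeEdge, mergeCorners, ha]; grind
  · have := M.white_involutive x
    simp only [removeEdge, mergeCorners, ha]; grind
  · simp only [removeEdge, ha]; grind

/-- The successive removal of edges does not depend on the choice of the sides of the edges. -/
theorem removeEdges_congr (e : X → X) (he : Function.Involutive e) (M : NonOrientedMap X)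
    (hM : ∀ x, M.edge x = e x ∨ (M.edge x = x ∧ M.edge (e x) = e x)) {l m : List X}
    (hlm : List.Forall₂ (fun x y => y = x ∨ y = e x) l m) :
    M.removeEdges l = M.removeEdges m := by
  induction hlm generalizing M with
  | nil => rfl
  | @cons a b l m hab _ ih =>
    have hrem : M.removeEdge b = M.removeEdge a := by
      rcases hab with rfl | rfl
      · rfl
      · rcases hM a with h | ⟨h, h₁⟩
        · rw [← h, removeEdge_edge]
        · rw [removeEdge_of_fixed M h, removeEdge_of_fixed M h₁]
    change (M.removeEdge a).removeEdges l = (M.removeEdge b).removeEdges m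
    rw [hrem]
    refine ih _ fun x => ?_
    have h1 := hM x
    have h2 := hM a
    have h3 := he a
    have h4 := he x
    have h5 := M.edge_involutive a
    simp only [removeEdge]
    grind

theorem side_mk (M : NonOrientedMap X) (x : M.sides) :
    Edge.side (Quot.mk _ x : M.Edge) = x ∨ Edge.side (Quot.mk _ x : M.Edge) = M.edge x := by
  have key : ∀ u v : M.sides, Relation.EqvGen (fun x y : M.sides => (y : X) = M.edge x) u v →
      (u : X) = v ∨ (u : X) = M.edge v := by
    intro u v h
    induction h with
    | rel u v h => right; rw [h, M.edge_involutive]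
    | refl u => left; rfl
    | symm u v _ ih =>
      rcases ih with ih | ih
      · exact Or.inl ih.symm
      · right; rw [ih, M.edge_involutive]
    | trans u v w _ _ ih1 ih2 =>
      have := M.edge_involutive (w : X)
      grind
  exact key _ _ (Quot.eqvGen_exact (Quot.out_eq (Quot.mk _ x : M.Edge)))

namespace IsIso

variable {f : X ≃ X} {M N : NonOrientedMap X}

theorem side_edgeEquiv (h : IsIso f M N) (e : M.Edge) :
    (h.edgeEquiv e).side = f e.side ∨ (h.edgeEquiv e).side = N.edge (f e.side) := by
  have he : h.edgeEquiv e = Quot.mk _ (h.sidesEquiv (Quot.out e)) := by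
    conv_lhs => rw [← Quot.out_eq e]
    rfl
  rw [he]
  exact side_mk N _

/-- The induced bijection of the histories. -/
def historyEquiv (h : IsIso f M N) : M.History ≃ N.History :=
  (Equiv.listEquivOfEquiv h.edgeEquiv).subtypeEquiv fun l => by
    simp only [Equiv.listEquivOfEquiv, Equiv.coe_fn_mk]
    rw [List.nodup_map_iff h.edgeEquiv.injective]
    refine and_congr Iff.rfl ⟨fun H e => ?_, fun H e => ?_⟩
    · exact List.mem_map.2 ⟨h.edgeEquiv.symm e, H _, by simp⟩
    · obtain ⟨e₁, h₁, h₂⟩ := List.mem_map.1 (H (h.edgeEquiv e))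
      rwa [← h.edgeEquiv.injective h₂]

theorem history_isTopDegree_iff (h : IsIso f M N) (l : M.History) :
    l.IsTopDegree ↔ (h.historyEquiv l).IsTopDegree := by
  have hval : (h.historyEquiv l).1 = l.1.map h.edgeEquiv := rfl
  have hst : ∀ i, (l.stage i).IsTopDegree ↔ ((h.historyEquiv l).stage i).IsTopDegree := by
    intro i
    have h1 := (h.removeEdges ((l.1.take i).map Edge.side)).isTopDegree_iff
    have h2 : (h.historyEquiv l).stage i
        = N.removeEdges (((l.1.take i).map Edge.side).map f) := by
      refine (removeEdges_congr N.edge N.edge_involutive N (fun x => Or.inl rfl) ?_).symm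
      rw [hval, ← List.map_take, List.map_map, List.map_map, List.forall₂_map_left_iff,
        List.forall₂_map_right_iff, List.forall₂_same]
      exact fun e _ => h.side_edgeEquiv e
    rw [h2]
    exact h1
  unfold History.IsTopDegree
  rw [hval, List.length_map]
  exact forall_congr' fun i => forall_congr' fun _ => hst i

theorem monTop_eq (h : IsIso f M N) : M.monTop = N.monTop := by
  unfold monTop
  rw [Nat.card_congr h.historyEquiv,
    Nat.card_congr (h.historyEquiv.subtypeEquiv h.history_isTopDegree_iff)]

end IsIso

instance [Finite X] : Finite (NonOrientedMap X) :=
  Finite.of_injective (fun M => (M.black, M.white, M.edge)) (by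
    intro M N h
    simp only [Prod.mk.injEq] at h
    exact NonOrientedMap.ext h.1 h.2.1 h.2.2)

end NonOrientedMap

/-- Labeled rooted non-oriented maps with `n` edges (that is, with base set of `2 * n` edge-sides)
and one face: one edge-side is decorated. -/
structure LabeledRootedOneFaceMap (n : ℕ) where
  map : NonOrientedMap (Fin (2 * n))
  root : Fin (2 * n)
  sides_eq : map.sides = Set.univ
  oneFace : Nat.card map.Face = 1

namespace LabeledRootedOneFaceMap

variable {n : ℕ}

instance : Finite (LabeledRootedOneFaceMap n) :=
  Finite.of_injective (fun M => (M.map, M.root)) (by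
    rintro ⟨M, r, _, _⟩ ⟨M₁, r₁, _, _⟩ h
    simp only [Prod.mk.injEq] at h
    obtain ⟨rfl, rfl⟩ := h
    rfl)

/-- Two labeled rooted maps differ only by the labels of the edge-sides. -/
instance relabelSetoid (n : ℕ) : Setoid (LabeledRootedOneFaceMap n) where
  r M N := ∃ f : Fin (2 * n) ≃ Fin (2 * n), NonOrientedMap.IsIso f M.map N.map ∧ f M.root = N.root
  iseqv :=
    { refl := fun M => ⟨Equiv.refl _, NonOrientedMap.IsIso.refl M.map, rfl⟩
      symm := by
        rintro M N ⟨f, h, hr⟩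
        exact ⟨f.symm, h.symm, by rw [← hr, Equiv.symm_apply_apply]⟩
      trans := by
        rintro M N K ⟨f, h, hr⟩ ⟨g, h₁, hr₁⟩
        exact ⟨f.trans g, h.trans h₁, by simp [hr, hr₁]⟩ }

end LabeledRootedOneFaceMap

/-- Non-oriented, unlabeled, rooted maps with `n` edges and one face. -/
abbrev RootedOneFaceMap (n : ℕ) : Type :=
  Quotient (LabeledRootedOneFaceMap.relabelSetoid n)

namespace RootedOneFaceMap

noncomputable instance (n : ℕ) : Fintype (RootedOneFaceMap n) := Fintype.ofFinite _

/-- The underlying bicolored graph. -/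
def graph {n : ℕ} (M : RootedOneFaceMap n) : UnlabeledGraph :=
  Quotient.map (fun M : LabeledRootedOneFaceMap n => M.map.graph)
    (by rintro _ _ ⟨_, h, _⟩; exact h.graph_isomorphic) M

/-- The probability that a uniformly random history is top-degree. -/
noncomputable def monTop {n : ℕ} (M : RootedOneFaceMap n) : ℚ :=
  Quotient.lift (fun M : LabeledRootedOneFaceMap n => M.map.monTop)
    (by rintro _ _ ⟨_, h, _⟩; exact h.monTop_eq) M

end RootedOneFaceMap

/-! Fix an order of the edges and build maps by adding edges one at a time, on both sides of the
identity. Adding an edge `a` to a pair of permutations that both fix `a` means choosing, for each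
color, the edge `p` before which `a` enters a cycle, or `p = a` for a new leaf. On vertex partitions
this identifies `a` with `p` (`sum_permsOn_cons`). Adding a ribbon to a non-oriented map with one
face per component means choosing the edge-sides next to a given side of the ribbon, one at each
end. Each old edge offers two sides, a new leaf offers one, and the effect on the partitions is the
same (`sum_topMaps_cons`).

The property "one face per component" survives exactly when both sides of the new ribbon lie on one
face. Twisting the ribbon pairs the insertions: if both ends attach to the same old component,
exactly one of the two twists is good, otherwise both are (`joins_add_joins_white`). Summed over
positions, attaching to `p` and `q` therefore has weight 1, 2, 2 or 4, according to how many classes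
of the common coarsening of the vertex partitions get merged. This is the factor by which `(1/2) ^
(number of classes)` changes (`half_pow_card_sup_links`). So the two recursions agree, and
`sum_perms_eq_sum_topMaps` holds for every fixed order and every weight depending only on the
partitions.

Restricting to connected maps makes the power of 1/2 constant. It remains to forget labels. Rooted
connected maps have no nontrivial automorphism, so an oriented class has `n!` labelings
(`card_fiber_rootedOrientedMap`). A one-face class has `2 ^ n * n! * monTop` labelings with standard
edges whose label order is a top-degree history, because relabeling the edges runs through all
histories uniformly (`card_relabelings`). The `2 * n` possible roots on one side against `n` on the
other absorb the remaining factor 1/2. -/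

open Equiv

/-! ### Equivalence relations, cycles and transpositions -/

/-- The equivalence relation generated by identifying `u` and `v`. -/
def linkSetoid {Y : Type} (u v : Y) : Setoid Y :=
  Relation.EqvGen.setoid fun x y => x = u ∧ y = v

theorem linkSetoid_le_iff {Y : Type} {u v : Y} {r : Setoid Y} : linkSetoid u v ≤ r ↔ r u v := by
  constructor
  · intro h
    exact h (Relation.EqvGen.rel _ _ ⟨rfl, rfl⟩)
  · intro h
    refine Setoid.eqvGen_le ?_
    rintro _ _ ⟨rfl, rfl⟩
    exact h

theorem linkSetoid_rel {Y : Type} (u v : Y) : linkSetoid u v u v :=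
  linkSetoid_le_iff.1 le_rfl

theorem card_quotient_sup_link_of_rel {Y : Type} {r : Setoid Y} {u v : Y} (h : r u v) :
    Nat.card (Quotient (r ⊔ linkSetoid u v)) = Nat.card (Quotient r) := by
  rw [sup_eq_left.2 (linkSetoid_le_iff.2 h)]

/-- The joined relation is the kernel of the map `g` that redirects the class of `v` to the class of
`u`; the image of `g` misses exactly the class of `v`. -/
theorem card_quotient_sup_link_of_not_rel {Y : Type} [Finite Y] {r : Setoid Y} {u v : Y}
    (h : ¬ r u v) :
    Nat.card (Quotient (r ⊔ linkSetoid u v)) + 1 = Nat.card (Quotient r) := by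
  classical
  let g : Y → Quotient r := fun y =>
    if (Quotient.mk r y) = Quotient.mk r v then Quotient.mk r u else Quotient.mk r y
  have hmk : ∀ a b, Quotient.mk r a = Quotient.mk r b ↔ r a b := fun a b => Quotient.eq
  have hker : r ⊔ linkSetoid u v = Setoid.ker g := by
    apply le_antisymm
    · refine sup_le ?_ (linkSetoid_le_iff.2 ?_)
      · intro a b hab
        have hab' := (hmk a b).2 hab
        simp only [Setoid.ker_def, g, hab']
      · simp [Setoid.ker_def, g]
    · have key : ∀ a, (r ⊔ linkSetoid u v) a (if r a v then u else a) := by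
        intro a
        split_ifs with hav
        · have h1 : (r ⊔ linkSetoid u v) a v := (le_sup_left : r ≤ _) hav
          have h2 : (r ⊔ linkSetoid u v) u v :=
            (le_sup_right : linkSetoid u v ≤ _) (linkSetoid_rel u v)
          exact Setoid.trans' _ h1 (Setoid.symm' _ h2)
        · exact Setoid.refl' _ a
      intro a b hab
      have h1 : r (if r a v then u else a) (if r b v then u else b) := by
        rw [← hmk]
        simp only [Setoid.ker_def, g, hmk] at hab
        split_ifs at hab ⊢ <;> exact hab
      exact Setoid.trans' _ (key a)
        (Setoid.trans' _ ((le_sup_left : r ≤ _) h1) (Setoid.symm' _ (key b)))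
  have hrange : Set.range g = {Quotient.mk r v}ᶜ := by
    ext q
    simp only [Set.mem_range, Set.mem_compl_iff, Set.mem_singleton_iff]
    constructor
    · rintro ⟨y, rfl⟩
      simp only [g]
      split_ifs with hy
      · rw [hmk]; exact h
      · exact hy
    · induction q using Quotient.ind with
      | _ y => intro hq; exact ⟨y, by simp [g, hq]⟩
  rw [hker, Nat.card_congr (Setoid.quotientKerEquivRange g), hrange, Nat.card_coe_set_eq]
  have := Set.ncard_add_ncard_compl ({Quotient.mk r v} : Set (Quotient r))
  rw [Set.ncard_singleton] at this
  omega

theorem Equiv.Perm.sameCycle_setoid_le_iff {Y : Type} {σ : Equiv.Perm Y} {r : Setoid Y} :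
    Equiv.Perm.SameCycle.setoid σ ≤ r ↔ ∀ x, r x (σ x) := by
  constructor
  · intro h x
    exact h (Equiv.Perm.SameCycle.refl σ x).apply_right
  · intro h x y hxy
    obtain ⟨k, rfl⟩ := hxy
    induction k using Int.induction_on with
    | zero => exact Setoid.refl' _ _
    | succ i ih =>
      rw [add_comm, zpow_add, Equiv.Perm.mul_apply, zpow_one]
      exact Setoid.trans' _ ih (h _)
    | pred i ih =>
      refine Setoid.trans' _ ih (Setoid.symm' _ ?_)
      have := h ((σ ^ (-(i : ℤ) - 1)) x)
      rwa [← Equiv.Perm.mul_apply, ← zpow_one_add, show 1 + (-(i : ℤ) - 1) = -i by ring] at this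

/-- The product inserts the fixed point `a` into the cycle of `p`, just before `p`: the old preimage
of `p` now goes to `a`, and `a` to `p`. -/
theorem Equiv.Perm.sameCycle_setoid_swap_mul {Y : Type} [DecidableEq Y] {σ : Equiv.Perm Y} {a : Y}
    (ha : σ a = a) (p : Y) :
    Equiv.Perm.SameCycle.setoid (Equiv.swap a p * σ) =
      Equiv.Perm.SameCycle.setoid σ ⊔ linkSetoid a p := by
  apply le_antisymm
  · rw [Equiv.Perm.sameCycle_setoid_le_iff]
    intro x
    have h1 : (Equiv.Perm.SameCycle.setoid σ ⊔ linkSetoid a p) x (σ x) :=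
      (le_sup_left : Equiv.Perm.SameCycle.setoid σ ≤ _) (Equiv.Perm.SameCycle.refl σ x).apply_right
    have h2 : (Equiv.Perm.SameCycle.setoid σ ⊔ linkSetoid a p) a p :=
      (le_sup_right : linkSetoid a p ≤ _) (linkSetoid_rel a p)
    rw [Equiv.Perm.mul_apply]
    refine Setoid.trans' _ h1 ?_
    rcases eq_or_ne (σ x) a with h | h
    · rw [h, Equiv.swap_apply_left]; exact h2
    rcases eq_or_ne (σ x) p with h' | h'
    · rw [h', Equiv.swap_apply_right]; exact Setoid.symm' _ h2
    · rw [Equiv.swap_apply_of_ne_of_ne h h']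
  · have hstep : ∀ x, Equiv.Perm.SameCycle.setoid (Equiv.swap a p * σ) x
        ((Equiv.swap a p * σ) x) := Equiv.Perm.sameCycle_setoid_le_iff.1 le_rfl
    have hap : Equiv.Perm.SameCycle.setoid (Equiv.swap a p * σ) a p := by
      have := hstep a
      rwa [Equiv.Perm.mul_apply, ha, Equiv.swap_apply_left] at this
    refine sup_le (Equiv.Perm.sameCycle_setoid_le_iff.2 fun x => ?_) (linkSetoid_le_iff.2 hap)
    have hx := hstep x
    rw [Equiv.Perm.mul_apply] at hx
    rcases eq_or_ne (σ x) a with h | h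
    · rw [h, Equiv.swap_apply_left] at hx
      rw [h]
      exact Setoid.trans' _ hx (Setoid.symm' _ hap)
    rcases eq_or_ne (σ x) p with h' | h'
    · rw [h', Equiv.swap_apply_right] at hx
      rw [h']
      exact Setoid.trans' _ hx hap
    · rwa [Equiv.swap_apply_of_ne_of_ne h h'] at hx

/-! ### Insertion of an edge -/

namespace NonOrientedMap

variable {X : Type}

open Classical in
/-- Split the corner `{x, f x}` by a new ribbon with sides `a`, `b`, so that the new corners are
`{a, x}` and `{b, f x}`; if `x = b`, the new ribbon forms a new vertex with the corner `{a, b}`. -/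
noncomputable def splitCorner (f : X → X) (a b x : X) : X → X := fun z =>
  if z = a then x else if z = b then (if x = b then a else f x)
  else if z = x then a else if z = f x then b else f z

theorem splitCorner_involutive {f : X → X} (hf : Function.Involutive f) {a b x : X}
    (hab : a ≠ b) (ha : f a = a) (hb : f b = b) (hx : x = b ∨ f x ≠ x) :
    Function.Involutive (splitCorner f a b x) := by
  intro z
  have h1 := hf x
  have h2 := hf z
  unfold splitCorner
  grind

theorem splitCorner_eq_self_iff {f : X → X} (hf : Function.Involutive f) {a b x : X}
    (hab : a ≠ b) (ha : f a = a) (hb : f b = b) (hx : x = b ∨ f x ≠ x) (z : X) :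
    splitCorner f a b x z = z ↔ z ≠ a ∧ z ≠ b ∧ f z = z := by
  have h1 := hf x
  have h2 := hf z
  unfold splitCorner
  grind

open Classical in
/-- Insert a new edge with sides `a`, `b` so that the black, respectively white, corner next to `a`
is `{a, x}`, respectively `{a, y}`. -/
noncomputable def insertEdge (M : NonOrientedMap X) {a b : X} (x y : X) (hab : a ≠ b)
    (ha : M.edge a = a) (hb : M.edge b = b) (hx : x = b ∨ M.edge x ≠ x)
    (hy : y = b ∨ M.edge y ≠ y) : NonOrientedMap X where
  black := splitCorner M.black a b x
  white := splitCorner M.white a b y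
  edge := fun z => if z = a then b else if z = b then a else M.edge z
  black_involutive := splitCorner_involutive M.black_involutive hab
    ((M.black_eq_self_iff a).2 ha) ((M.black_eq_self_iff b).2 hb)
    (hx.imp id fun h => mt (M.black_eq_self_iff x).1 h)
  white_involutive := splitCorner_involutive M.white_involutive hab
    ((M.white_eq_self_iff a).2 ha) ((M.white_eq_self_iff b).2 hb)
    (hy.imp id fun h => mt (M.white_eq_self_iff y).1 h)
  edge_involutive := by
    intro z
    have := M.edge_involutive z
    grind
  black_eq_self_iff z := by
    rw [splitCorner_eq_self_iff M.black_involutive hab ((M.black_eq_self_iff a).2 ha)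
      ((M.black_eq_self_iff b).2 hb) (hx.imp id fun h => mt (M.black_eq_self_iff x).1 h),
      M.black_eq_self_iff]
    grind
  white_eq_self_iff z := by
    rw [splitCorner_eq_self_iff M.white_involutive hab ((M.white_eq_self_iff a).2 ha)
      ((M.white_eq_self_iff b).2 hb) (hy.imp id fun h => mt (M.white_eq_self_iff y).1 h),
      M.white_eq_self_iff]
    grind

theorem mergeCorners_splitCorner {e f : X → X} (hf : Function.Involutive f) {a b x : X}
    (hab : a ≠ b) (ha : f a = a) (hb : f b = b) (hea : e a = b)
    (heb : e b = a) : mergeCorners e (splitCorner f a b x) a = f := by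
  ext z
  have h1 := hf x
  have h2 := hf z
  unfold mergeCorners splitCorner
  grind

theorem splitCorner_mergeCorners {e f : X → X} (he : Function.Involutive e)
    (hf : Function.Involutive f) (hfix : ∀ x, f x = x ↔ e x = x) {a : X} (ha : e a ≠ a) :
    splitCorner (mergeCorners e f a) a (e a) (f a) = f := by
  ext z
  have h0 := he a
  have h1 := hf a
  have h2 := hf z
  have h3 := hfix a
  have h4 := hfix (e a)
  have h5 := hf (e a)
  have h6 := hfix z
  unfold mergeCorners splitCorner
  grind

/-- Together with `insertEdge_removeEdge` this makes a map with the edge `a` equivalent to the map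
without it and the two neighbors of side `a`, black and white. -/
theorem removeEdge_insertEdge (M : NonOrientedMap X) {a b : X} (x y : X) (hab : a ≠ b)
    (ha : M.edge a = a) (hb : M.edge b = b) (hx : x = b ∨ M.edge x ≠ x)
    (hy : y = b ∨ M.edge y ≠ y) : (M.insertEdge x y hab ha hb hx hy).removeEdge a = M := by
  have hE : (M.insertEdge x y hab ha hb hx hy).edge a = b := by simp [insertEdge]
  have hE' : (M.insertEdge x y hab ha hb hx hy).edge b = a := by simp [insertEdge, hab.symm]
  apply NonOrientedMap.ext
  · exact mergeCorners_splitCorner M.black_involutive hab ((M.black_eq_self_iff a).2 ha)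
      ((M.black_eq_self_iff b).2 hb) hE hE'
  · exact mergeCorners_splitCorner M.white_involutive hab ((M.white_eq_self_iff a).2 ha)
      ((M.white_eq_self_iff b).2 hb) hE hE'
  · ext z
    simp only [removeEdge, hE]
    simp only [insertEdge]
    grind

theorem removeEdge_edge_self (M : NonOrientedMap X) (a : X) : (M.removeEdge a).edge a = a := by
  simp [removeEdge]

theorem removeEdge_edge_other (M : NonOrientedMap X) (a : X) :
    (M.removeEdge a).edge (M.edge a) = M.edge a := by
  simp [removeEdge]

theorem black_insertable (M : NonOrientedMap X) {a : X} (ha : M.edge a ≠ a) :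
    M.black a = M.edge a ∨ (M.removeEdge a).edge (M.black a) ≠ M.black a := by
  have h1 := M.black_eq_self_iff a
  have h2 := M.black_eq_self_iff (M.black a)
  have h3 := M.black_involutive a
  simp only [removeEdge]
  grind

theorem white_insertable (M : NonOrientedMap X) {a : X} (ha : M.edge a ≠ a) :
    M.white a = M.edge a ∨ (M.removeEdge a).edge (M.white a) ≠ M.white a := by
  have h1 := M.white_eq_self_iff a
  have h2 := M.white_eq_self_iff (M.white a)
  have h3 := M.white_involutive a
  simp only [removeEdge]
  grind

theorem insertEdge_removeEdge (M : NonOrientedMap X) {a : X} (ha : M.edge a ≠ a) :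
    (M.removeEdge a).insertEdge (M.black a) (M.white a) ha.symm (M.removeEdge_edge_self a)
      (M.removeEdge_edge_other a) (M.black_insertable ha) (M.white_insertable ha) = M := by
  apply NonOrientedMap.ext
  · exact splitCorner_mergeCorners M.edge_involutive M.black_involutive M.black_eq_self_iff ha
  · exact splitCorner_mergeCorners M.edge_involutive M.white_involutive M.white_eq_self_iff ha
  · ext z
    have := M.edge_involutive a
    simp only [insertEdge, removeEdge]
    grind

/-! ### Faces -/

/-- The equivalence relation on `X` whose classes are the faces and the elements outside the base
set. -/
def faceSetoid (M : NonOrientedMap X) : Setoid X :=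
  Relation.EqvGen.setoid fun x y => y = M.black x ∨ y = M.white x

theorem faceSetoid_black (M : NonOrientedMap X) (x : X) : M.faceSetoid x (M.black x) :=
  Relation.EqvGen.rel _ _ (Or.inl rfl)

theorem faceSetoid_white (M : NonOrientedMap X) (x : X) : M.faceSetoid x (M.white x) :=
  Relation.EqvGen.rel _ _ (Or.inr rfl)

theorem faceSetoid_le_iff {M : NonOrientedMap X} {r : Setoid X} :
    M.faceSetoid ≤ r ↔ ∀ x, r x (M.black x) ∧ r x (M.white x) := by
  constructor
  · exact fun h x => ⟨h (M.faceSetoid_black x), h (M.faceSetoid_white x)⟩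
  · intro h
    refine Setoid.eqvGen_le ?_
    rintro x _ (rfl | rfl)
    exacts [(h x).1, (h x).2]

/-- No generating step enters or leaves `A`, so a chain between two elements of `A` stays in `A`.
This allows faces to be handled on all of `X` instead of the subtype of sides. -/
theorem eqvGen_subtype_iff {r : X → X → Prop} {A : Set X} (hA : ∀ x y, r x y → (x ∈ A ↔ y ∈ A))
    (u v : A) : Relation.EqvGen (fun x y : A => r x y) u v ↔ Relation.EqvGen r u v := by
  constructor
  · intro h
    induction h with
    | rel _ _ h => exact Relation.EqvGen.rel _ _ h
    | refl _ => exact Relation.EqvGen.refl _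
    | symm _ _ _ ih => exact Relation.EqvGen.symm _ _ ih
    | trans _ _ _ _ _ ih1 ih2 => exact Relation.EqvGen.trans _ _ _ ih1 ih2
  · have key : ∀ x y, Relation.EqvGen r x y → (x ∈ A ↔ y ∈ A) ∧ ∀ (hx : x ∈ A) (hy : y ∈ A),
        Relation.EqvGen (fun x y : A => r x y) ⟨x, hx⟩ ⟨y, hy⟩ := by
      intro x y h
      induction h with
      | rel x y h => exact ⟨hA x y h, fun _ _ => Relation.EqvGen.rel _ _ h⟩
      | refl x => exact ⟨Iff.rfl, fun _ _ => Relation.EqvGen.refl _⟩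
      | symm x y _ ih => exact ⟨ih.1.symm, fun hx hy => Relation.EqvGen.symm _ _ (ih.2 hy hx)⟩
      | trans x y z _ _ ih1 ih2 =>
        exact ⟨ih1.1.trans ih2.1, fun hx hz => Relation.EqvGen.trans _ _ _
          (ih1.2 hx (ih1.1.1 hx)) (ih2.2 (ih1.1.1 hx) hz)⟩
    exact fun h => (key _ _ h).2 u.2 v.2

theorem mem_sides_black (M : NonOrientedMap X) (x : X) : x ∈ M.sides ↔ M.black x ∈ M.sides := by
  have h1 := M.black_eq_self_iff x
  have h2 := M.black_eq_self_iff (M.black x)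
  have h3 := M.black_involutive x
  simp only [sides, Set.mem_ofPred_eq, ne_eq]
  grind

theorem mem_sides_white (M : NonOrientedMap X) (x : X) : x ∈ M.sides ↔ M.white x ∈ M.sides := by
  have h1 := M.white_eq_self_iff x
  have h2 := M.white_eq_self_iff (M.white x)
  have h3 := M.white_involutive x
  simp only [sides, Set.mem_ofPred_eq, ne_eq]
  grind

theorem mem_sides_edge (M : NonOrientedMap X) (x : X) : x ∈ M.sides ↔ M.edge x ∈ M.sides := by
  have h3 := M.edge_involutive x
  simp only [sides, Set.mem_ofPred_eq, ne_eq]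
  grind

theorem face_mk_eq_iff (M : NonOrientedMap X) (x y : M.sides) :
    (Quot.mk _ x : M.Face) = Quot.mk _ y ↔ M.faceSetoid x y := by
  rw [Quot.eq]
  refine eqvGen_subtype_iff (r := fun x y => y = M.black x ∨ y = M.white x) ?_ x y
  rintro x _ (rfl | rfl)
  exacts [M.mem_sides_black x, M.mem_sides_white x]

/-- The number of faces is the number of components if and only if the two sides of each edge belong
to the same face. -/
theorem isTopDegree_iff_faceSetoid [Finite X] (M : NonOrientedMap X) :
    M.IsTopDegree ↔ ∀ x, M.faceSetoid x (M.edge x) := by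
  let g : M.Face → M.Component := Quot.map id fun x y h => h.elim Or.inl fun h => Or.inr (Or.inl h)
  have hg : Function.Surjective g := by rintro ⟨x⟩; exact ⟨Quot.mk _ x, rfl⟩
  have : Finite M.Face := Finite.of_surjective (Quot.mk _) Quot.mk_surjective
  constructor
  · intro h x
    -- The faces surject onto the components; with equal finite cardinalities the surjection is
    -- injective, so two sides in one component are in one face.
    have hinj : Function.Injective g :=
      ((Nat.bijective_iff_surjective_and_card g).2 ⟨hg, h⟩).1
    by_cases hx : x ∈ M.sides
    · have := @hinj (Quot.mk _ ⟨x, hx⟩) (Quot.mk _ ⟨M.edge x, (M.mem_sides_edge x).1 hx⟩)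
        (Quot.sound (Or.inr (Or.inr rfl)))
      exact (M.face_mk_eq_iff _ _).1 this
    · have : M.edge x = x := by simpa [sides] using hx
      rw [this]
  · intro h
    refine Nat.card_eq_of_bijective g ⟨?_, hg⟩
    let g' : M.Component → M.Face := Quot.lift (Quot.mk _) (by
      intro x y hxy
      refine (M.face_mk_eq_iff x y).2 ?_
      rcases hxy with hxy | hxy | hxy <;> rw [hxy]
      · exact M.faceSetoid_black x
      · exact M.faceSetoid_white x
      · exact h x)
    have : Function.LeftInverse g' g := by rintro ⟨x⟩; rfl
    exact this.injective

end NonOrientedMap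

/-! ### Walking along the boundary of a face -/

namespace NonOrientedMap

variable {X : Type}

theorem black_mem_sides {M : NonOrientedMap X} {x : X} (hx : x ∈ M.sides) : M.black x ∈ M.sides :=
  (M.mem_sides_black x).1 hx

theorem white_mem_sides {M : NonOrientedMap X} {x : X} (hx : x ∈ M.sides) : M.white x ∈ M.sides :=
  (M.mem_sides_white x).1 hx

theorem black_ne_self {M : NonOrientedMap X} {x : X} (hx : x ∈ M.sides) : M.black x ≠ x :=
  mt (M.black_eq_self_iff x).1 hx

theorem white_ne_self {M : NonOrientedMap X} {x : X} (hx : x ∈ M.sides) : M.white x ≠ x :=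
  mt (M.white_eq_self_iff x).1 hx

/-- The permutation that moves each edge-side by two steps along the boundary of its face. -/
def rotation (M : NonOrientedMap X) : Equiv.Perm X :=
  M.black_involutive.toPerm * M.white_involutive.toPerm

theorem rotation_apply (M : NonOrientedMap X) (x : X) : M.rotation x = M.black (M.white x) := rfl

/-- As in a dihedral group, the reflection `white` conjugates the rotation to its inverse. -/
theorem rotation_white_rotation (M : NonOrientedMap X) (x : X) :
    M.rotation (M.white (M.rotation x)) = M.white x := by
  simp only [rotation_apply, M.white_involutive _, M.black_involutive _]

theorem white_rotation_pow (M : NonOrientedMap X) (k : ℕ) (x : X) :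
    (M.rotation ^ k) (M.white ((M.rotation ^ k) x)) = M.white x := by
  induction k generalizing x with
  | zero => rfl
  | succ k ih =>
    have h := M.rotation_white_rotation ((M.rotation ^ k) x)
    have h1 : (M.rotation ^ (k + 1)) x = M.rotation ((M.rotation ^ k) x) := by
      rw [pow_succ', Perm.mul_apply]
    rw [h1, pow_succ, Perm.mul_apply, h, ih]

theorem rotation_pow_mem_sides {M : NonOrientedMap X} {x : X} (hx : x ∈ M.sides) (k : ℕ) :
    (M.rotation ^ k) x ∈ M.sides := by
  induction k with
  | zero => exact hx
  | succ k ih =>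
    rw [pow_succ', Perm.mul_apply]
    exact black_mem_sides (white_mem_sides ih)

/-- Cutting such an equality in the middle with `white_rotation_pow` would give a side fixed by a
reflection: by `white` if `k` is even, by `black` if `k` is odd. Hence the rotation never reverses
the direction of travel around a face. -/
theorem rotation_pow_ne_white [Finite X] {M : NonOrientedMap X} {x : X} (hx : x ∈ M.sides) (k : ℕ) :
    (M.rotation ^ k) x ≠ M.white x := by
  intro h
  obtain ⟨j, hj⟩ | ⟨j, hj⟩ := Nat.even_or_odd k
  · have h1 := M.white_rotation_pow j x
    rw [← h, hj, pow_add, Perm.mul_apply] at h1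
    exact white_ne_self (rotation_pow_mem_sides hx j) ((M.rotation ^ j).injective h1)
  · have h1 := M.white_rotation_pow j x
    rw [← h, hj, two_mul, add_assoc, pow_add, Perm.mul_apply, pow_succ', Perm.mul_apply,
      rotation_apply] at h1
    exact black_ne_self (white_mem_sides (rotation_pow_mem_sides hx j))
      ((M.rotation ^ j).injective h1).symm

theorem not_sameCycle_white [Finite X] {M : NonOrientedMap X} {x : X} (hx : x ∈ M.sides) :
    ¬ M.rotation.SameCycle x (M.white x) := by
  intro h
  obtain ⟨k, hk⟩ := h.exists_nat_pow_eq
  exact rotation_pow_ne_white hx k hk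

theorem not_sameCycle_black [Finite X] {M : NonOrientedMap X} {x : X} (hx : x ∈ M.sides) :
    ¬ M.rotation.SameCycle x (M.black x) := by
  intro h
  refine not_sameCycle_white hx ?_
  have h1 : M.black x = M.rotation (M.white x) := by
    rw [rotation_apply, M.white_involutive]
  rw [h1] at h
  exact Perm.sameCycle_apply_right.1 h

/-- A face consists of the two rotation orbits of `x` and `white x`, one for each direction of
travel; each of `black` and `white` exchanges them. -/
theorem sameCycle_or_of_faceSetoid {M : NonOrientedMap X} {x y : X} (h : M.faceSetoid x y) :
    M.rotation.SameCycle x y ∨ M.rotation.SameCycle x (M.white y) := by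
  let P : X → Prop := fun u => M.rotation.SameCycle x u ∨ M.rotation.SameCycle x (M.white u)
  have hW : ∀ u, P u → P (M.white u) := by
    rintro u (h | h)
    · right; rwa [M.white_involutive]
    · exact Or.inl h
  have hB : ∀ u, P u → P (M.black u) := by
    rintro u (h | h)
    · right
      rw [← Perm.sameCycle_apply_right, rotation_apply, M.white_involutive, M.black_involutive]
      exact h
    · left
      have h2 := Perm.sameCycle_apply_right.2 h
      rwa [rotation_apply, M.white_involutive] at h2
  -- Pulling `Iff` back along a predicate gives an equivalence relation, so invariance of the
  -- predicate needs checking only on generators.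
  have hle : M.faceSetoid ≤ Setoid.comap P ⟨Iff, ⟨Iff.refl, Iff.symm, Iff.trans⟩⟩ := by
    rw [faceSetoid_le_iff]
    intro u
    refine ⟨⟨hB u, fun h => ?_⟩, ⟨hW u, fun h => ?_⟩⟩
    · simpa only [M.black_involutive u] using hB _ h
    · simpa only [M.white_involutive u] using hW _ h
  exact (hle h).1 (Or.inl (Perm.SameCycle.refl _ _))

/-- After the insertion of an edge with sides `a`, `b` at the positions `x`, `y`, the two sides of
this edge belong to the same face. -/
def Joins (M : NonOrientedMap X) (a b x y : X) : Prop :=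
  Relation.EqvGen.setoid (fun u v => v = splitCorner M.black a b x u ∨
    v = splitCorner M.white a b y u) a b

/-! ### Which insertions of a ribbon keep one face per component -/

section Insertion

variable {M : NonOrientedMap X} {a b x y : X}

theorem joins_of_black_leaf (M : NonOrientedMap X) (a b y : X) : M.Joins a b b y :=
  Relation.EqvGen.rel _ _ (Or.inl (by simp [splitCorner]))

theorem joins_of_white_leaf (M : NonOrientedMap X) (a b x : X) : M.Joins a b x b :=
  Relation.EqvGen.rel _ _ (Or.inr (by simp [splitCorner]))

/-- The only corner lost is `{x, f x}`, and it is recovered by the chain `x`, `a`, `b`, `f x`. If `x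
= b`, no old corner is lost. -/
theorem rel_of_split {f : X → X} (hf : Function.Involutive f) (ha : f a = a) (hb : f b = b)
    (hab : a ≠ b) {r : Setoid X} (hr : ∀ z, r z (splitCorner f a b x z)) (h : r a b) (z : X) :
    r z (f z) := by
  have hx := hr a
  have hx' := hr b
  by_cases hza : z = a
  · rw [hza, ha]
  by_cases hzb : z = b
  · rw [hzb, hb]
  by_cases hxb : x = b
  · have h1 := hr z
    rw [show splitCorner f a b x z = f z by unfold splitCorner; grind] at h1
    exact h1
  rw [show splitCorner f a b x a = x by unfold splitCorner; grind] at hx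
  rw [show splitCorner f a b x b = f x by unfold splitCorner; grind] at hx'
  have hxx : r x (f x) := Setoid.trans' _ (Setoid.symm' _ hx) (Setoid.trans' _ h hx')
  by_cases hzx : z = x
  · rw [hzx]; exact hxx
  by_cases hzx' : z = f x
  · rw [hzx', hf]; exact Setoid.symm' _ hxx
  have h1 := hr z
  rwa [show splitCorner f a b x z = f z by unfold splitCorner; grind] at h1

open Classical in
/-- The insertion of an edge preserves the property of having one face in each component if and only
if the two sides of the new edge belong to the same face. -/
theorem isTopDegree_insertEdge_iff [Finite X] (hab : a ≠ b) (ha : M.edge a = a) (hb : M.edge b = b)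
    (hx : x = b ∨ M.edge x ≠ x) (hy : y = b ∨ M.edge y ≠ y) (hM : M.IsTopDegree) :
    (M.insertEdge x y hab ha hb hx hy).IsTopDegree ↔ M.Joins a b x y := by
  set K := M.insertEdge x y hab ha hb hx hy
  rw [isTopDegree_iff_faceSetoid] at hM ⊢
  change _ ↔ K.faceSetoid a b
  have hE : ∀ z, K.edge z = if z = a then b else if z = b then a else M.edge z := by
    intro z; simp only [K, insertEdge]
  constructor
  · intro h
    have := h a
    rwa [hE, if_pos rfl] at this
  · intro h z
    -- Once `a` and `b` share a face, no old face has been cut, so every old edge still has both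
    -- sides in one face.
    have hle : M.faceSetoid ≤ K.faceSetoid := by
      rw [faceSetoid_le_iff]
      exact fun z => ⟨rel_of_split M.black_involutive ((M.black_eq_self_iff a).2 ha)
        ((M.black_eq_self_iff b).2 hb) hab K.faceSetoid_black h z,
        rel_of_split M.white_involutive ((M.white_eq_self_iff a).2 ha)
        ((M.white_eq_self_iff b).2 hb) hab K.faceSetoid_white h z⟩
    rw [hE]
    split_ifs with h1 h2
    · rw [h1]; exact h
    · rw [h2]; exact Setoid.symm' _ h
    · exact hle (hM z)

variable [Finite X]

/-- Each rotation step crosses a white corner and then a black one. The hypotheses keep the walk off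
the split corners `{y, white y}` and `{x, black x}`, so it survives in the new map; `black x` itself
is unreachable, being in the opposite orbit. -/
theorem rel_rotation_pow (ha : M.edge a = a) (hb : M.edge b = b) (hx : x ∈ M.sides)
    {r : Setoid X} (hB : ∀ z, r z (splitCorner M.black a b x z))
    (hW : ∀ z, r z (splitCorner M.white a b y z)) (i : ℕ)
    (h1 : ∀ j < i, (M.rotation ^ j) x ≠ y ∧ (M.rotation ^ j) x ≠ M.white y)
    (h2 : ∀ j < i, (M.rotation ^ (j + 1)) x ≠ x) : r x ((M.rotation ^ i) x) := by
  induction i with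
  | zero => exact Setoid.refl' _ x
  | succ i ih =>
    refine Setoid.trans' _ (ih (fun j hj => h1 j (by omega)) fun j hj => h2 j (by omega)) ?_
    have h1i := h1 i (by omega)
    have h2i := h2 i (by omega)
    have hmem := rotation_pow_mem_sides hx i
    have hcyc : M.rotation.SameCycle x ((M.rotation ^ (i + 1)) x) :=
      ⟨((i + 1 : ℕ) : ℤ), by rw [zpow_natCast]⟩
    rw [pow_succ', Perm.mul_apply] at h2i hcyc ⊢
    set z := (M.rotation ^ i) x
    have hwz := white_mem_sides hmem
    have hna : ∀ u ∈ M.sides, u ≠ a := by rintro u hu rfl; exact hu ha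
    have hnb : ∀ u ∈ M.sides, u ≠ b := by rintro u hu rfl; exact hu hb
    have s1 : splitCorner M.white a b y z = M.white z := by
      have := hna z hmem; have := hnb z hmem
      unfold splitCorner; grind
    have hbx : M.black x ≠ M.rotation z := by
      intro h
      exact not_sameCycle_black hx (h ▸ hcyc)
    rw [rotation_apply] at h2i hbx ⊢
    have s2 : splitCorner M.black a b x (M.white z) = M.black (M.white z) := by
      have := hna _ hwz; have := hnb _ hwz
      have := M.black_involutive x
      unfold splitCorner; grind
    have r1 := hW z
    have r2 := hB (M.white z)
    rw [s1] at r1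
    rw [s2] at r2
    exact Setoid.trans' _ r1 r2

/-- The split white corner is not on the face of `x`, so the walk from `x` goes all the way round to
`black x`. The two new black corners connect these ends to `a` and `b`. -/
theorem joins_of_not_faceSetoid (ha : M.edge a = a) (hb : M.edge b = b)
    (hx : x ∈ M.sides) (h : ¬ M.faceSetoid x y) : M.Joins a b x y := by
  set r := Relation.EqvGen.setoid (fun u v => v = splitCorner M.black a b x u ∨
    v = splitCorner M.white a b y u) with hr
  have hB : ∀ z, r z (splitCorner M.black a b x z) := fun z => Relation.EqvGen.rel _ _ (Or.inl rfl)
  have hW : ∀ z, r z (splitCorner M.white a b y z) := fun z => Relation.EqvGen.rel _ _ (Or.inr rfl)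
  have hface : ∀ j, M.faceSetoid x ((M.rotation ^ j) x) := by
    intro j
    induction j with
    | zero => exact Setoid.refl' _ _
    | succ j ih =>
      rw [pow_succ', Perm.mul_apply]
      exact Setoid.trans' _ ih (Setoid.trans' _ (M.faceSetoid_white _) (M.faceSetoid_black _))
  have h1 : ∀ j, (M.rotation ^ j) x ≠ y ∧ (M.rotation ^ j) x ≠ M.white y := by
    intro j
    refine ⟨fun e => h (e ▸ hface j), fun e => h ?_⟩
    exact Setoid.trans' _ (e ▸ hface j) (Setoid.symm' _ (M.faceSetoid_white y))
  -- With `k + 1` the first return time, the walk stops one rotation early, where the white neighbor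
  -- is `black x`.
  have hex : ∃ k, (M.rotation ^ (k + 1)) x = x := by
    obtain ⟨k, hk⟩ := (Perm.SameCycle.refl M.rotation x).symm.exists_pow_eq''
    have h0 := hk.1
    exact ⟨k - 1, by rw [Nat.sub_add_cancel h0]; exact hk.2.2⟩
  classical
  have hk := Nat.find_spec hex
  have hmin := fun j (hj : j < Nat.find hex) => Nat.find_min hex hj
  set k := Nat.find hex
  have r1 := rel_rotation_pow ha hb hx hB hW k (fun j _ => h1 j) hmin
  have hmem := rotation_pow_mem_sides hx k
  rw [pow_succ', Perm.mul_apply, rotation_apply] at hk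
  have h1k := h1 k
  set z := (M.rotation ^ k) x
  have hwz : M.white z = M.black x := by rw [← hk, M.black_involutive]
  have hna : ∀ u ∈ M.sides, u ≠ a := by rintro u hu rfl; exact hu ha
  have hnb : ∀ u ∈ M.sides, u ≠ b := by rintro u hu rfl; exact hu hb
  have r2 := hW z
  rw [show splitCorner M.white a b y z = M.black x by
    have := hna z hmem; have := hnb z hmem
    unfold splitCorner; grind] at r2
  have r3 := hB (M.black x)
  rw [show splitCorner M.black a b x (M.black x) = b by
    have := hna _ (black_mem_sides hx); have := hnb _ (black_mem_sides hx)
    have := black_ne_self hx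
    unfold splitCorner; grind] at r3
  have r0 := hB a
  rw [show splitCorner M.black a b x a = x by unfold splitCorner; grind] at r0
  exact Setoid.trans' _ r0 (Setoid.trans' _ r1 (Setoid.trans' _ r2 r3))

/-- The walk from `x`, which is adjacent to `a`, meets the split white corner from its end `white
y`, which is now adjacent to `b`. -/
theorem joins_of_sameCycle_white (hab : a ≠ b) (ha : M.edge a = a) (hb : M.edge b = b)
    (hx : x ∈ M.sides) (hy : y ∈ M.sides) (h : M.rotation.SameCycle x (M.white y)) :
    M.Joins a b x y := by
  set r := Relation.EqvGen.setoid (fun u v => v = splitCorner M.black a b x u ∨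
    v = splitCorner M.white a b y u) with hr
  have hB : ∀ z, r z (splitCorner M.black a b x z) := fun z => Relation.EqvGen.rel _ _ (Or.inl rfl)
  have hW : ∀ z, r z (splitCorner M.white a b y z) := fun z => Relation.EqvGen.rel _ _ (Or.inr rfl)
  have hex := h.exists_nat_pow_eq
  have hny : ∀ j : ℕ, (M.rotation ^ j) x ≠ y := by
    rintro j rfl
    exact not_sameCycle_white hy (Perm.sameCycle_pow_left.2 h)
  classical
  have hk := Nat.find_spec hex
  have hmin := fun j (hj : j < Nat.find hex) => Nat.find_min hex hj
  set k := Nat.find hex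
  -- Deleting a full turn from the walk would reach the target sooner than its first hitting time
  -- `k`.
  have hnx : ∀ j < k, (M.rotation ^ (j + 1)) x ≠ x := by
    intro j hj e
    refine hmin (k - (j + 1)) (by omega) ?_
    conv_lhs => rw [← e]
    rw [← Perm.mul_apply, ← pow_add, Nat.sub_add_cancel hj]
    exact hk
  have r1 := rel_rotation_pow ha hb hx hB hW k (fun j hj => ⟨hny j, hmin j hj⟩) hnx
  rw [hk] at r1
  have r0 := hB a
  rw [show splitCorner M.black a b x a = x by unfold splitCorner; grind] at r0
  have r2 := hW b
  rw [show splitCorner M.white a b y b = M.white y by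
    have : y ≠ b := by rintro rfl; exact hy hb
    unfold splitCorner; grind] at r2
  exact Setoid.trans' _ r0 (Setoid.trans' _ r1 (Setoid.symm' _ r2))

/-- Now the walk from `x` meets the split white corner from its end `y`, which is adjacent to `a`:
the face through `a` closes up without meeting `b`. -/
theorem not_joins_of_sameCycle (hab : a ≠ b) (ha : M.edge a = a) (hb : M.edge b = b)
    (hx : x ∈ M.sides) (hy : y ∈ M.sides) (h : M.rotation.SameCycle x y) :
    ¬ M.Joins a b x y := by
  have hex := h.exists_nat_pow_eq
  classical
  have hk := Nat.find_spec hex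
  have hmin := fun j (hj : j < Nat.find hex) => Nat.find_min hex hj
  set k := Nat.find hex
  have hnx : ∀ j < k, (M.rotation ^ (j + 1)) x ≠ x := by
    intro j hj e
    refine hmin (k - (j + 1)) (by omega) ?_
    conv_lhs => rw [← e]
    rw [← Perm.mul_apply, ← pow_add, Nat.sub_add_cancel hj]
    exact hk
  have hmem := rotation_pow_mem_sides hx
  have hna : ∀ u ∈ M.sides, u ≠ a := by rintro u hu rfl; exact hu ha
  have hnb : ∀ u ∈ M.sides, u ≠ b := by rintro u hu rfl; exact hu hb
  have hnwy : ∀ j : ℕ, (M.rotation ^ j) x ≠ M.white y := by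
    intro j e
    refine not_sameCycle_white hy (h.symm.trans ?_)
    rw [← e]
    exact ⟨(j : ℤ), by rw [zpow_natCast]⟩
  have hnbx : ∀ j : ℕ, (M.rotation ^ j) x ≠ M.black x := by
    intro j e
    refine not_sameCycle_black hx ?_
    rw [← e]
    exact ⟨(j : ℤ), by rw [zpow_natCast]⟩
  have hsucc : ∀ j : ℕ, (M.rotation ^ (j + 1)) x = M.black (M.white ((M.rotation ^ j) x)) := by
    intro j
    rw [pow_succ', Perm.mul_apply, rotation_apply]
  -- `P` is the whole closed walk `a`, `x`, ..., `y`, `a`. Points reached after a full rotation step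
  -- run up to index `k`, the intermediate white neighbors only to `k - 1`, since at `y` the walk
  -- turns back to `a`.
  let P : X → Prop := fun z => z = a ∨ (∃ i ≤ k, z = (M.rotation ^ i) x) ∨
    ∃ i < k, z = M.white ((M.rotation ^ i) x)
  have hP : ∀ i ≤ k, P ((M.rotation ^ i) x) := fun i hi => Or.inr (Or.inl ⟨i, hi, rfl⟩)
  have hP' : ∀ i < k, P (M.white ((M.rotation ^ i) x)) :=
    fun i hi => Or.inr (Or.inr ⟨i, hi, rfl⟩)
  have hB : ∀ z, P z → P (splitCorner M.black a b x z) := by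
    rintro z (rfl | ⟨i, hi, rfl⟩ | ⟨i, hi, rfl⟩)
    · rw [show splitCorner M.black z b x z = x by unfold splitCorner; grind]
      exact hP 0 (Nat.zero_le _)
    · rcases i with _ | i
      · rw [show splitCorner M.black a b x ((M.rotation ^ 0) x) = a by
          have := hna x hx; have := hnb x hx
          rw [pow_zero, Perm.one_apply]
          unfold splitCorner; grind]
        exact Or.inl rfl
      · rw [show splitCorner M.black a b x ((M.rotation ^ (i + 1)) x) =
            M.white ((M.rotation ^ i) x) by
          have := hna _ (hmem (i + 1)); have := hnb _ (hmem (i + 1))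
          have := hnx i hi; have := hnbx (i + 1)
          have := M.black_involutive (M.white ((M.rotation ^ i) x))
          have := hsucc i
          unfold splitCorner; grind]
        exact hP' i hi
    · rw [show splitCorner M.black a b x (M.white ((M.rotation ^ i) x)) =
            (M.rotation ^ (i + 1)) x by
          have := hna _ (white_mem_sides (hmem i)); have := hnb _ (white_mem_sides (hmem i))
          have := hnx i hi; have := hnbx (i + 1)
          have := M.black_involutive x
          have := hsucc i
          unfold splitCorner; grind]
      exact hP (i + 1) hi
  have hW : ∀ z, P z → P (splitCorner M.white a b y z) := by
    rintro z (rfl | ⟨i, hi, rfl⟩ | ⟨i, hi, rfl⟩)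
    · rw [show splitCorner M.white z b y z = y by unfold splitCorner; grind, ← hk]
      exact hP k le_rfl
    · by_cases hiy : (M.rotation ^ i) x = y
      · rw [hiy, show splitCorner M.white a b y y = a by
          have := hna y hy; have := hnb y hy
          unfold splitCorner; grind]
        exact Or.inl rfl
      · rw [show splitCorner M.white a b y ((M.rotation ^ i) x) = M.white ((M.rotation ^ i) x) by
          have := hna _ (hmem i); have := hnb _ (hmem i); have := hnwy i
          unfold splitCorner; grind]
        refine hP' i (lt_of_le_of_ne hi ?_)
        rintro rfl
        exact hiy hk
    · rw [show splitCorner M.white a b y (M.white ((M.rotation ^ i) x)) = (M.rotation ^ i) x by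
          have := hna _ (white_mem_sides (hmem i)); have := hnb _ (white_mem_sides (hmem i))
          have := hmin i hi; have := hnwy i
          have := M.white_involutive y; have := M.white_involutive ((M.rotation ^ i) x)
          unfold splitCorner; grind]
      exact hP i hi.le
  have hBi : Function.Involutive (splitCorner M.black a b x) :=
    splitCorner_involutive M.black_involutive hab ((M.black_eq_self_iff a).2 ha)
      ((M.black_eq_self_iff b).2 hb) (Or.inr (black_ne_self hx))
  have hWi : Function.Involutive (splitCorner M.white a b y) :=
    splitCorner_involutive M.white_involutive hab ((M.white_eq_self_iff a).2 ha)
      ((M.white_eq_self_iff b).2 hb) (Or.inr (white_ne_self hy))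
  intro hJ
  have hle : Relation.EqvGen.setoid (fun u v => v = splitCorner M.black a b x u ∨
      v = splitCorner M.white a b y u) ≤
        Setoid.comap P ⟨Iff, ⟨Iff.refl, Iff.symm, Iff.trans⟩⟩ := by
    refine Setoid.eqvGen_le ?_
    rintro u _ (rfl | rfl)
    · exact ⟨hB u, fun h => by simpa only [hBi u] using hB _ h⟩
    · exact ⟨hW u, fun h => by simpa only [hWi u] using hW _ h⟩
  have hPb : P b := (hle hJ).1 (Or.inl rfl)
  rcases hPb with h | ⟨i, _, h⟩ | ⟨i, _, h⟩
  · exact hab h.symm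
  · exact hnb _ (hmem i) h.symm
  · exact hnb _ (white_mem_sides (hmem i)) h.symm

open Classical in
/-- Twisting a new ribbon that connects two corners of the same face changes whether the face is
split. -/
theorem joins_add_joins_white (hab : a ≠ b) (ha : M.edge a = a) (hb : M.edge b = b)
    (hx : x = b ∨ M.edge x ≠ x) (hy : y = b ∨ M.edge y ≠ y) :
    ((if M.Joins a b x y then 1 else 0) + (if M.Joins a b x (M.white y) then 1 else 0) : ℚ) =
      2 * if x ≠ b ∧ M.faceSetoid x y then 1 / 2 else 1 := by
  rcases hx with rfl | hx
  · rw [if_pos (joins_of_black_leaf M a x y), if_pos (joins_of_black_leaf M a x _)]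
    norm_num
  have hxb : x ≠ b := by rintro rfl; exact hx hb
  rcases hy with rfl | hy
  · have h1 : ¬ M.faceSetoid x y := by
      intro h
      have hwy : M.white y = y := (M.white_eq_self_iff y).2 hb
      obtain ⟨k, hk⟩ : ∃ k : ℕ, (M.rotation ^ k) x = y := by
        have h2 := sameCycle_or_of_faceSetoid h
        rw [hwy, or_self] at h2
        exact h2.exists_nat_pow_eq
      exact (hk ▸ rotation_pow_mem_sides hx k : y ∈ M.sides) hb
    -- For a white leaf the twist fixes the position, so both summands are the same insertion, which
    -- always joins.
    rw [(M.white_eq_self_iff y).2 hb, if_pos (joins_of_white_leaf M a y x),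
      if_neg (show ¬(x ≠ y ∧ M.faceSetoid x y) by tauto)]
    norm_num
  have hwy : M.white y ∈ M.sides := white_mem_sides hy
  have hww := M.white_involutive y
  by_cases hf : M.faceSetoid x y
  · rw [if_pos (show x ≠ b ∧ M.faceSetoid x y from ⟨hxb, hf⟩)]
    rcases sameCycle_or_of_faceSetoid hf with h | h
    · rw [if_neg (not_joins_of_sameCycle hab ha hb hx hy h),
        if_pos (joins_of_sameCycle_white hab ha hb hx hwy (by rwa [hww]))]
      norm_num
    · rw [if_pos (joins_of_sameCycle_white hab ha hb hx hy h),
        if_neg (not_joins_of_sameCycle hab ha hb hx hwy h)]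
      norm_num
  · have hf' : ¬ M.faceSetoid x (M.white y) := fun h =>
      hf (Setoid.trans' _ h (Setoid.symm' _ (M.faceSetoid_white y)))
    rw [if_neg (show ¬(x ≠ b ∧ M.faceSetoid x y) by tauto), if_pos (joins_of_not_faceSetoid ha hb hx hf),
      if_pos (joins_of_not_faceSetoid ha hb hx hf')]
    norm_num

end Insertion

end NonOrientedMap

/-! ### Attachment weights and the number of classes -/

theorem card_quotient_bot (Y : Type) : Nat.card (Quotient (⊥ : Setoid Y)) = Nat.card Y :=
  (Nat.card_eq_of_bijective (Quotient.mk (⊥ : Setoid Y))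
    ⟨fun _ _ h => Quotient.exact h, Quotient.mk_surjective⟩).symm

theorem sup_link_congr {Y : Type} {r : Setoid Y} {a p q : Y} (h : r p q) :
    r ⊔ linkSetoid a p = r ⊔ linkSetoid a q := by
  have key : ∀ p q, r p q → r ⊔ linkSetoid a p ≤ r ⊔ linkSetoid a q := by
    intro p q h
    refine sup_le le_sup_left (linkSetoid_le_iff.2 ?_)
    exact Setoid.trans' _ ((le_sup_right : _ ≤ r ⊔ linkSetoid a q) (linkSetoid_rel a q))
      ((le_sup_left : _ ≤ r ⊔ linkSetoid a q) (Setoid.symm' _ h))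
  exact le_antisymm (key p q h) (key q p (Setoid.symm' _ h))

theorem sup_link_eq_self {Y : Type} (r : Setoid Y) (a : Y) : r ⊔ linkSetoid a a = r :=
  sup_eq_left.2 (linkSetoid_le_iff.2 (Setoid.refl' _ a))

open Classical in
/-- The number of sides at the position `p` next to which a ribbon end of the edge `a` can be
inserted. -/
noncomputable def sideWeight {Y : Type} (a p : Y) : ℚ := if p = a then 1 else 2

open Classical in
/-- The proportion of the insertions of the edge `a` at the positions `p`, `q` that do not split a
face. -/
noncomputable def joinWeight {Y : Type} (a : Y) (r : Setoid Y) (p q : Y) : ℚ :=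
  if p ≠ a ∧ r p q then 1 / 2 else 1

/-- As `a` is alone in its class, linking it to `p` produces the class of `p` with `a` adjoined and
leaves all other classes alone. -/
theorem sup_link_rel_iff {Y : Type} {r : Setoid Y} {a p q : Y} (ha : ∀ y, r a y → y = a)
    (hp : p ≠ a) (hq : q ≠ a) : (r ⊔ linkSetoid a p) a q ↔ r p q := by
  constructor
  · intro h
    let g : Y → Prop := fun y => y = a ∨ r p y
    have hle : r ⊔ linkSetoid a p ≤ Setoid.comap g ⟨Iff, ⟨Iff.refl, Iff.symm, Iff.trans⟩⟩ := by
      refine sup_le ?_ (linkSetoid_le_iff.2 ?_)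
      · intro u v huv
        change (u = a ∨ r p u) ↔ (v = a ∨ r p v)
        constructor
        · rintro (rfl | h)
          · exact Or.inl (ha v huv)
          · exact Or.inr (Setoid.trans' _ h huv)
        · rintro (rfl | h)
          · exact Or.inl (ha u (Setoid.symm' _ huv))
          · exact Or.inr (Setoid.trans' _ h (Setoid.symm' _ huv))
      · exact ⟨fun _ => Or.inr (Setoid.refl' _ p), fun _ => Or.inl rfl⟩
    exact ((hle h).1 (Or.inl rfl)).resolve_left hq
  · intro h
    exact Setoid.trans' _ ((le_sup_right : _ ≤ r ⊔ linkSetoid a p) (linkSetoid_rel a p))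
      ((le_sup_left : _ ≤ r ⊔ linkSetoid a p) h)

/-- Every link that really merges two classes doubles the power of 1/2. A link of `a` to itself
merges nothing, and the second link merges nothing if `p` and `q` were already related; the latter
is the 1/2 in `joinWeight`. The weights on the right are those of ribbon insertions. -/
theorem half_pow_card_sup_links {Y : Type} [Finite Y] {r : Setoid Y} {a : Y}
    (ha : ∀ y, r a y → y = a) (p q : Y) :
    (1 / 2 : ℚ) ^ Nat.card (Quotient (r ⊔ linkSetoid a p ⊔ linkSetoid a q)) =
      (1 / 2) ^ Nat.card (Quotient r) * (sideWeight a p * sideWeight a q * joinWeight a r p q) := by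
  have hone : ∀ p, p ≠ a → (1 / 2 : ℚ) ^ Nat.card (Quotient (r ⊔ linkSetoid a p)) =
      (1 / 2) ^ Nat.card (Quotient r) * 2 := by
    intro p hp
    rw [← card_quotient_sup_link_of_not_rel (fun h => hp (ha p h)), pow_succ]
    ring
  unfold sideWeight joinWeight
  by_cases hp : p = a
  · subst hp
    rw [sup_link_eq_self]
    by_cases hq : q = p
    · subst hq
      rw [sup_link_eq_self]
      simp
    · rw [hone q hq]
      simp [hq]
  · by_cases hq : q = a
    · subst hq
      rw [sup_link_eq_self, hone p hp]
      have : ¬ r p q := fun h => hp (ha p (Setoid.symm' _ h))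
      simp [hp, this]
    · by_cases h : r p q
      · rw [card_quotient_sup_link_of_rel ((sup_link_rel_iff ha hp hq).2 h), hone p hp]
        simp [hp, hq, h]
      · have := card_quotient_sup_link_of_not_rel (mt (sup_link_rel_iff ha hp hq).1 h)
        have h2 := hone p hp
        rw [← this, pow_succ] at h2
        simp only [hp, hq, h, if_false, and_false]
        linarith

/-! ### Labeled edges and vertex partitions -/

/-- Two-sided edges: `X` is the set of the sides of the edges labeled by `Y`. -/
structure EdgeLabeling (Y X : Type) where
  label : X → Y
  side : Y → X
  flip : X → X
  flip_flip : ∀ x, flip (flip x) = x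
  flip_ne : ∀ x, flip x ≠ x
  label_side : ∀ y, label (side y) = y
  label_eq_iff : ∀ x z, label x = label z ↔ z = x ∨ z = flip x

namespace EdgeLabeling

variable {Y X : Type} (Λ : EdgeLabeling Y X)

theorem label_flip (x : X) : Λ.label (Λ.flip x) = Λ.label x :=
  ((Λ.label_eq_iff _ _).2 (Or.inr rfl)).symm

theorem eq_of_label_eq {x : X} {a : Y} (h : Λ.label x = a) :
    x = Λ.side a ∨ x = Λ.flip (Λ.side a) := by
  rw [← Λ.label_eq_iff, Λ.label_side, h]

/-- The edges of `M` are the ones labeled by the elements of `l`. -/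
def HasEdges (M : NonOrientedMap X) (l : List Y) : Prop :=
  ∀ x, (Λ.label x ∈ l → M.edge x = Λ.flip x) ∧ (Λ.label x ∉ l → M.edge x = x)

/-- At each step of the removal of the edges in the order given by `l` the number of faces is the
number of connected components. -/
def AllTop (M : NonOrientedMap X) (l : List Y) : Prop :=
  ∀ i ≤ l.length, (M.removeEdges ((l.take i).map Λ.side)).IsTopDegree

theorem allTop_nil (M : NonOrientedMap X) : Λ.AllTop M [] ↔ M.IsTopDegree := by
  simp [AllTop, NonOrientedMap.removeEdges]

theorem allTop_cons (M : NonOrientedMap X) (a : Y) (l : List Y) :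
    Λ.AllTop M (a :: l) ↔ M.IsTopDegree ∧ Λ.AllTop (M.removeEdge (Λ.side a)) l := by
  constructor
  · intro h
    refine ⟨by simpa [NonOrientedMap.removeEdges] using h 0 (Nat.zero_le _), fun i hi => ?_⟩
    simpa [NonOrientedMap.removeEdges] using h (i + 1) (by simpa using hi)
  · rintro ⟨h1, h2⟩ i hi
    rcases i with _ | i
    · simpa [NonOrientedMap.removeEdges] using h1
    · simpa [NonOrientedMap.removeEdges] using h2 i (by simpa using hi)

theorem AllTop.isTopDegree {Λ : EdgeLabeling Y X} {M : NonOrientedMap X} {l : List Y}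
    (h : Λ.AllTop M l) : M.IsTopDegree := by
  simpa [NonOrientedMap.removeEdges] using h 0 (Nat.zero_le _)

/-- The partition of the edges into vertices, the corners being paired by `f`. -/
def cornerSetoid (f : X → X) : Setoid Y :=
  Relation.EqvGen.setoid fun u v => ∃ x, Λ.label x = u ∧ Λ.label (f x) = v

theorem cornerSetoid_le_iff {f : X → X} {r : Setoid Y} :
    Λ.cornerSetoid f ≤ r ↔ ∀ x, r (Λ.label x) (Λ.label (f x)) := by
  constructor
  · exact fun h x => h (Relation.EqvGen.rel _ _ ⟨x, rfl, rfl⟩)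
  · intro h
    refine Setoid.eqvGen_le ?_
    rintro _ _ ⟨x, rfl, rfl⟩
    exact h x

theorem cornerSetoid_rel (f : X → X) (x : X) :
    Λ.cornerSetoid f (Λ.label x) (Λ.label (f x)) :=
  Λ.cornerSetoid_le_iff.1 le_rfl x

/-- Both sides of the new ribbon carry the label `a`, so on labels the two halves of the split
corner are glued again, with `a` attached to that vertex. For a leaf the added link is trivial. -/
theorem cornerSetoid_splitCorner {f : X → X} (hf : Function.Involutive f) {a : Y}
    (ha : f (Λ.side a) = Λ.side a) (hb : f (Λ.flip (Λ.side a)) = Λ.flip (Λ.side a)) (x : X) :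
    Λ.cornerSetoid (NonOrientedMap.splitCorner f (Λ.side a) (Λ.flip (Λ.side a)) x) =
      Λ.cornerSetoid f ⊔ linkSetoid a (Λ.label x) := by
  have hsa := Λ.label_side a
  have hsb : Λ.label (Λ.flip (Λ.side a)) = a := by rw [Λ.label_flip, hsa]
  apply le_antisymm
  · rw [cornerSetoid_le_iff]
    intro z
    have hl : (Λ.cornerSetoid f ⊔ linkSetoid a (Λ.label x)) a (Λ.label x) :=
      (le_sup_right : linkSetoid a (Λ.label x) ≤ _) (linkSetoid_rel _ _)
    have hc : ∀ z, (Λ.cornerSetoid f ⊔ linkSetoid a (Λ.label x)) (Λ.label z) (Λ.label (f z)) :=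
      fun z => (le_sup_left : Λ.cornerSetoid f ≤ _) (Λ.cornerSetoid_rel f z)
    unfold NonOrientedMap.splitCorner
    split_ifs with h1 h2 h3 h4 h5
    · rw [h1, hsa]; exact hl
    · rw [h2, hsb, hsa]
    · rw [h2, hsb]; exact Setoid.trans' _ hl (hc x)
    · rw [h4, hsa]; exact Setoid.symm' _ hl
    · rw [h5, hsb]; exact Setoid.symm' _ (Setoid.trans' _ hl (hc x))
    · exact hc z
  · refine sup_le ?_ (linkSetoid_le_iff.2 ?_)
    · rw [cornerSetoid_le_iff]
      refine NonOrientedMap.rel_of_split (r := Setoid.comap Λ.label (Λ.cornerSetoid _)) hf ha hb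
        (Λ.flip_ne _).symm (Λ.cornerSetoid_rel _) ?_
      rw [Setoid.comap_rel, hsa, hsb]
    · have := Λ.cornerSetoid_rel
        (NonOrientedMap.splitCorner f (Λ.side a) (Λ.flip (Λ.side a)) x) (Λ.side a)
      rwa [hsa, show NonOrientedMap.splitCorner f (Λ.side a) (Λ.flip (Λ.side a)) x (Λ.side a) = x by
        simp [NonOrientedMap.splitCorner]] at this

section

variable {Λ} {M : NonOrientedMap X} {l : List Y}

theorem HasEdges.edge_ne_iff (h : Λ.HasEdges M l) (x : X) :
    M.edge x ≠ x ↔ Λ.label x ∈ l := by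
  by_cases hx : Λ.label x ∈ l
  · simp [(h x).1 hx, hx, Λ.flip_ne]
  · simp [(h x).2 hx, hx]

theorem HasEdges.edge_eq (h : Λ.HasEdges M l) {x : X} (hx : Λ.label x ∉ l) : M.edge x = x :=
  (h x).2 hx

theorem HasEdges.removeEdge {a : Y} (h : Λ.HasEdges M (a :: l)) (ha : a ∉ l) :
    Λ.HasEdges (M.removeEdge (Λ.side a)) l := by
  intro x
  have h0 := h (Λ.side a)
  have h1 := h x
  have h2 := Λ.label_side a
  have h3 := Λ.label_flip (Λ.side a)
  have h4 := Λ.eq_of_label_eq (x := x) (a := a)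
  simp only [NonOrientedMap.removeEdge]
  grind

theorem HasEdges.insertEdge {a : Y} (h : Λ.HasEdges M l) (x y : X) (hab ha hb hx hy) :
    Λ.HasEdges (M.insertEdge (a := Λ.side a) (b := Λ.flip (Λ.side a)) x y hab ha hb hx hy)
      (a :: l) := by
  intro z
  have h1 := h z
  have h2 := Λ.label_side a
  have h3 := Λ.label_flip (Λ.side a)
  have h4 := Λ.eq_of_label_eq (x := z) (a := a)
  have h5 := Λ.flip_flip (Λ.side a)
  simp only [NonOrientedMap.insertEdge]
  grind

/-- In a map with one face in each component, two sides belong to the same face if and only if their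
edges belong to the same component. -/
theorem HasEdges.faceSetoid_iff [Finite X] (h : Λ.HasEdges M l) (ht : M.IsTopDegree) {x y : X}
    (hx : Λ.label x ∈ l) (hy : Λ.label y ∈ l) :
    M.faceSetoid x y ↔
      (Λ.cornerSetoid M.black ⊔ Λ.cornerSetoid M.white) (Λ.label x) (Λ.label y) := by
  rw [NonOrientedMap.isTopDegree_iff_faceSetoid] at ht
  constructor
  · have : M.faceSetoid ≤
        Setoid.comap Λ.label (Λ.cornerSetoid M.black ⊔ Λ.cornerSetoid M.white) := by
      rw [NonOrientedMap.faceSetoid_le_iff]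
      exact fun x => ⟨(le_sup_left : Λ.cornerSetoid M.black ≤ _) (Λ.cornerSetoid_rel _ x),
        (le_sup_right : Λ.cornerSetoid M.white ≤ _) (Λ.cornerSetoid_rel _ x)⟩
    exact fun h => this h
  · have hside : ∀ z, Λ.label z ∈ l → M.faceSetoid z (Λ.side (Λ.label z)) := by
      intro z hz
      rcases Λ.eq_of_label_eq (x := z) rfl with hs | hs
      · rw [← hs]
      · have h1 := ht z
        rw [(h z).1 hz] at h1
        rwa [show Λ.flip z = Λ.side (Λ.label z) by
          conv_lhs => rw [hs]
          rw [Λ.flip_flip]] at h1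
    have hgen : ∀ f : X → X, (∀ z, M.faceSetoid z (f z)) → (∀ z, f z = z ↔ M.edge z = z) →
        (∀ z, z ∈ M.sides ↔ f z ∈ M.sides) →
        Λ.cornerSetoid f ≤ Setoid.comap Λ.side M.faceSetoid := by
      intro f hf hfix hmem
      rw [cornerSetoid_le_iff]
      intro z
      rw [Setoid.comap_rel]
      by_cases hz : Λ.label z ∈ l
      · have hfz : Λ.label (f z) ∈ l :=
          (h.edge_ne_iff _).1 ((hmem z).1 ((h.edge_ne_iff z).2 hz))
        exact Setoid.trans' _ (Setoid.symm' _ (hside z hz)) (Setoid.trans' _ (hf z) (hside _ hfz))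
      · rw [(hfix z).2 (h.edge_eq hz)]
    intro hxy
    have hle : Λ.cornerSetoid M.black ⊔ Λ.cornerSetoid M.white ≤
        Setoid.comap Λ.side M.faceSetoid :=
      sup_le (hgen _ M.faceSetoid_black M.black_eq_self_iff M.mem_sides_black)
        (hgen _ M.faceSetoid_white M.white_eq_self_iff M.mem_sides_white)
    exact Setoid.trans' _ (hside x hx) (Setoid.trans' _ (hle hxy) (Setoid.symm' _ (hside y hy)))

end

end EdgeLabeling

/-! ### The recursion for non-oriented maps -/

namespace EdgeLabeling

variable {Y X : Type} (Λ : EdgeLabeling Y X)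

theorem edge_side_of_hasEdges {a : Y} {l : List Y} (ha : a ∉ l) {M : NonOrientedMap X}
    (h : Λ.HasEdges M l) : M.edge (Λ.side a) = Λ.side a ∧
      M.edge (Λ.flip (Λ.side a)) = Λ.flip (Λ.side a) :=
  ⟨h.edge_eq (by rwa [Λ.label_side]), h.edge_eq (by rwa [Λ.label_flip, Λ.label_side])⟩

section Counting

variable [Fintype X]

noncomputable instance : Fintype (NonOrientedMap X) := Fintype.ofFinite _

open Classical in
/-- The maps with edges `l` such that at each step of the removal of the edges in this order the
number of faces is the number of connected components. -/
noncomputable def topMaps (l : List Y) : Finset (NonOrientedMap X) :=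
  Finset.univ.filter fun M => Λ.HasEdges M l ∧ Λ.AllTop M l

theorem mem_topMaps {l : List Y} {M : NonOrientedMap X} :
    M ∈ Λ.topMaps l ↔ Λ.HasEdges M l ∧ Λ.AllTop M l := by simp [topMaps]

open Classical in
/-- The possible positions of the new edge `a` at its black, or white, extremity. -/
noncomputable def positions (a : Y) (l : List Y) : Finset X :=
  Finset.univ.filter fun x => x = Λ.flip (Λ.side a) ∨ Λ.label x ∈ l

theorem mem_positions {a : Y} {l : List Y} {x : X} :
    x ∈ Λ.positions a l ↔ x = Λ.flip (Λ.side a) ∨ Λ.label x ∈ l := by simp [positions]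

theorem eq_or_edge_ne_of_mem_positions {a : Y} {l : List Y} {M : NonOrientedMap X}
    (h : Λ.HasEdges M l) {x : X} (hx : x ∈ Λ.positions a l) :
    x = Λ.flip (Λ.side a) ∨ M.edge x ≠ x :=
  (Λ.mem_positions.1 hx).imp id (h.edge_ne_iff x).2

-- Removing the first edge and remembering the two neighbors of its chosen side is a bijection, with
-- insertion as inverse. Given that the smaller map passes all tests, the only new test is that the
-- two sides of the inserted edge share a face.
open Classical in
theorem sum_topMaps_cons {a : Y} {l : List Y} (ha : a ∉ l) (φ : Setoid Y → Setoid Y → ℚ) :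
    ∑ K ∈ Λ.topMaps (a :: l), φ (Λ.cornerSetoid K.black) (Λ.cornerSetoid K.white) =
      ∑ M ∈ Λ.topMaps l, ∑ x ∈ Λ.positions a l, ∑ y ∈ Λ.positions a l,
        if M.Joins (Λ.side a) (Λ.flip (Λ.side a)) x y then
          φ (Λ.cornerSetoid M.black ⊔ linkSetoid a (Λ.label x))
            (Λ.cornerSetoid M.white ⊔ linkSetoid a (Λ.label y)) else 0 := by
  simp_rw [← Finset.sum_product']
  rw [← Finset.sum_filter]
  have hne : Λ.side a ≠ Λ.flip (Λ.side a) := (Λ.flip_ne _).symm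
  have hedge : ∀ K, Λ.HasEdges K (a :: l) → K.edge (Λ.side a) = Λ.flip (Λ.side a) :=
    fun K hK => (hK _).1 (by rw [Λ.label_side]; exact List.mem_cons_self)
  have hins : ∀ K (hK : Λ.HasEdges K (a :: l)), ∃ hab ha' hb hx hy,
      (K.removeEdge (Λ.side a)).insertEdge (a := Λ.side a) (b := Λ.flip (Λ.side a))
        (K.black (Λ.side a)) (K.white (Λ.side a)) hab ha' hb hx hy = K := by
    intro K hK
    have h1 := hedge K hK
    have h2 : K.edge (Λ.side a) ≠ Λ.side a := h1 ▸ Λ.flip_ne _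
    rw [← h1]
    exact ⟨_, _, _, _, _, K.insertEdge_removeEdge h2⟩
  have hpos : ∀ K, Λ.HasEdges K (a :: l) → ∀ x, (x = Λ.flip (Λ.side a) ∨
      (K.removeEdge (Λ.side a)).edge x ≠ x) → x ∈ Λ.positions a l := by
    intro K hK x hx
    exact Λ.mem_positions.2 (hx.imp id ((hK.removeEdge ha).edge_ne_iff x).1)
  refine Finset.sum_nbij (fun K => (K.removeEdge (Λ.side a), K.black (Λ.side a),
    K.white (Λ.side a))) ?_ ?_ ?_ ?_
  · intro K hK
    obtain ⟨hK, ht⟩ := Λ.mem_topMaps.1 hK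
    obtain ⟨hab, ha', hb, hx, hy, hins⟩ := hins K hK
    rw [allTop_cons] at ht
    simp only [Finset.mem_filter, Finset.mem_product]
    refine ⟨⟨Λ.mem_topMaps.2 ⟨hK.removeEdge ha, ht.2⟩, hpos K hK _ hx, hpos K hK _ hy⟩, ?_⟩
    rw [← NonOrientedMap.isTopDegree_insertEdge_iff hab ha' hb hx hy ht.2.isTopDegree, hins]
    exact ht.1
  · intro K hK K' hK' h
    obtain ⟨hK, -⟩ := Λ.mem_topMaps.1 hK
    obtain ⟨hK', -⟩ := Λ.mem_topMaps.1 hK'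
    obtain ⟨hab, ha', hb, hx, hy, hins1⟩ := hins K hK
    obtain ⟨hab', ha'', hb', hx', hy', hins2⟩ := hins K' hK'
    simp only [Prod.mk.injEq] at h
    rw [← hins1, ← hins2]
    congr 1
    exacts [h.1, h.2.1, h.2.2]
  · rintro ⟨M, x, y⟩ h
    simp only [Finset.coe_filter, Finset.mem_product, Set.mem_ofPred_eq] at h
    obtain ⟨⟨hM, hx, hy⟩, hj⟩ := h
    obtain ⟨hM, ht⟩ := Λ.mem_topMaps.1 hM
    obtain ⟨ha', hb⟩ := Λ.edge_side_of_hasEdges ha hM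
    have hx' := Λ.eq_or_edge_ne_of_mem_positions hM hx
    have hy' := Λ.eq_or_edge_ne_of_mem_positions hM hy
    have hrem := M.removeEdge_insertEdge x y hne ha' hb hx' hy'
    refine ⟨M.insertEdge x y hne ha' hb hx' hy', ?_, ?_⟩
    · refine Finset.mem_coe.2 (Λ.mem_topMaps.2 ⟨hM.insertEdge x y _ _ _ _ _, ?_⟩)
      rw [allTop_cons, hrem]
      exact ⟨(NonOrientedMap.isTopDegree_insertEdge_iff hne ha' hb hx' hy' ht.isTopDegree).2 hj, ht⟩
    · simp only [Prod.mk.injEq]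
      refine ⟨hrem, ?_, ?_⟩ <;> simp [NonOrientedMap.insertEdge, NonOrientedMap.splitCorner]
  · intro K hK
    obtain ⟨hK, -⟩ := Λ.mem_topMaps.1 hK
    obtain ⟨hab, ha', hb, hx, hy, hins⟩ := hins K hK
    -- The smaller map and the two neighbors become free variables, so that `K` can be replaced by
    -- an insertion into `M`.
    generalize K.removeEdge (Λ.side a) = M at *
    generalize hx0 : K.black (Λ.side a) = x at *
    generalize hy0 : K.white (Λ.side a) = y at *
    subst hins
    congr 1
    · exact Λ.cornerSetoid_splitCorner M.black_involutive ((M.black_eq_self_iff _).2 ha')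
        ((M.black_eq_self_iff _).2 hb) x
    · exact Λ.cornerSetoid_splitCorner M.white_involutive ((M.white_eq_self_iff _).2 ha')
        ((M.white_eq_self_iff _).2 hb) y

-- A label `p ≠ a` in `l` has both of its sides among the positions, whereas the label `a`
-- contributes only the far side of the new ribbon.
open Classical in
theorem sum_positions {a : Y} {l : List Y} (ha : a ∉ l) (H : Y → ℚ) :
    ∑ x ∈ Λ.positions a l, H (Λ.label x) =
      ∑ p ∈ (a :: l).toFinset, sideWeight a p * H p := by
  have hlab : Λ.label (Λ.flip (Λ.side a)) = a := by rw [Λ.label_flip, Λ.label_side]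
  have hmaps : ∀ x ∈ Λ.positions a l, Λ.label x ∈ (a :: l).toFinset := by
    intro x hx
    rw [List.mem_toFinset, List.mem_cons]
    refine (Λ.mem_positions.1 hx).imp ?_ id
    rintro rfl
    exact hlab
  rw [← Finset.sum_fiberwise_of_maps_to hmaps]
  refine Finset.sum_congr rfl fun p hp => ?_
  rw [Finset.sum_congr rfl (g := fun _ => H p) fun x hx => by rw [(Finset.mem_filter.1 hx).2],
    Finset.sum_const, nsmul_eq_mul]
  congr 1
  rw [List.mem_toFinset, List.mem_cons] at hp
  unfold sideWeight
  split_ifs with hpa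
  · have : (Λ.positions a l).filter (fun x => Λ.label x = p) = {Λ.flip (Λ.side a)} := by
      ext x
      simp only [Finset.mem_filter, mem_positions, Finset.mem_singleton]
      grind
    rw [this, Finset.card_singleton, Nat.cast_one]
  · have : (Λ.positions a l).filter (fun x => Λ.label x = p) = {Λ.side p, Λ.flip (Λ.side p)} := by
      ext x
      have h1 := Λ.eq_of_label_eq (x := x) (a := p)
      have h2 := Λ.label_side p
      have h3 := Λ.label_flip (Λ.side p)
      simp only [Finset.mem_filter, mem_positions, Finset.mem_singleton, Finset.mem_insert]
      grind
    rw [this, Finset.card_pair (Λ.flip_ne _).symm]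
    norm_num

-- The involution `M.white` of the positions twists the ribbon without changing its white vertex,
-- hence without changing `G`. Adding the sum to its twisted copy gives twice the weighted sum;
-- fixed positions cause no difficulty, since nothing is split into pairs.
open Classical in
theorem sum_joins {a : Y} {l : List Y} (ha : a ∉ l) {M : NonOrientedMap X}
    (hM : M ∈ Λ.topMaps l) (G : Y → Y → ℚ)
    (hG : ∀ p q q', Λ.cornerSetoid M.white q q' → G p q = G p q') :
    (∑ x ∈ Λ.positions a l, ∑ y ∈ Λ.positions a l,
      if M.Joins (Λ.side a) (Λ.flip (Λ.side a)) x y then G (Λ.label x) (Λ.label y) else 0) =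
    ∑ p ∈ (a :: l).toFinset, ∑ q ∈ (a :: l).toFinset, sideWeight a p * sideWeight a q *
      joinWeight a (Λ.cornerSetoid M.black ⊔ Λ.cornerSetoid M.white) p q * G p q := by
  obtain ⟨hE, ht⟩ := Λ.mem_topMaps.1 hM
  obtain ⟨ha', hb⟩ := Λ.edge_side_of_hasEdges ha hE
  have hlab : Λ.label (Λ.flip (Λ.side a)) = a := by rw [Λ.label_flip, Λ.label_side]
  set r := Λ.cornerSetoid M.black ⊔ Λ.cornerSetoid M.white with hr
  have hwmem : ∀ y ∈ Λ.positions a l, M.white y ∈ Λ.positions a l := by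
    intro y hy
    rw [mem_positions] at hy ⊢
    refine hy.imp ?_ fun h => ?_
    · rintro rfl
      exact (M.white_eq_self_iff _).2 hb
    · exact (hE.edge_ne_iff _).1 (NonOrientedMap.white_mem_sides ((hE.edge_ne_iff y).2 h))
  have hinner : ∀ x ∈ Λ.positions a l, (∑ y ∈ Λ.positions a l,
      if M.Joins (Λ.side a) (Λ.flip (Λ.side a)) x y then G (Λ.label x) (Λ.label y) else 0) =
      ∑ y ∈ Λ.positions a l, joinWeight a r (Λ.label x) (Λ.label y) *
        G (Λ.label x) (Λ.label y) := by
    intro x hx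
    have hflip : (∑ y ∈ Λ.positions a l,
        if M.Joins (Λ.side a) (Λ.flip (Λ.side a)) x y then G (Λ.label x) (Λ.label y) else 0) =
        ∑ y ∈ Λ.positions a l, if M.Joins (Λ.side a) (Λ.flip (Λ.side a)) x (M.white y) then
          G (Λ.label x) (Λ.label y) else 0 := by
      refine Finset.sum_nbij' M.white M.white hwmem hwmem (fun y _ => M.white_involutive y)
        (fun y _ => M.white_involutive y) fun y _ => ?_
      rw [M.white_involutive, hG _ _ _ (Λ.cornerSetoid_rel M.white y)]
    have hsum : ∀ y ∈ Λ.positions a l,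
        ((if M.Joins (Λ.side a) (Λ.flip (Λ.side a)) x y then G (Λ.label x) (Λ.label y) else 0) +
          if M.Joins (Λ.side a) (Λ.flip (Λ.side a)) x (M.white y) then
            G (Λ.label x) (Λ.label y) else 0) =
          2 * (joinWeight a r (Λ.label x) (Λ.label y) * G (Λ.label x) (Λ.label y)) := by
      intro y hy
      have h1 := NonOrientedMap.joins_add_joins_white (Λ.flip_ne (Λ.side a)).symm ha' hb
        (Λ.eq_or_edge_ne_of_mem_positions hE hx) (Λ.eq_or_edge_ne_of_mem_positions hE hy)
      -- The twisting lemma speaks of faces, the weight of components; they agree because `M` has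
      -- one face per component, and a leaf position is related to no old edge in either sense.
      have h2 : joinWeight a r (Λ.label x) (Λ.label y) =
          if x ≠ Λ.flip (Λ.side a) ∧ M.faceSetoid x y then 1 / 2 else 1 := by
        unfold joinWeight
        refine if_congr ?_ rfl rfl
        rcases Λ.mem_positions.1 hx with rfl | hx
        · simp [hlab]
        have hxa : Λ.label x ≠ a := fun h => ha (h ▸ hx)
        have hxb : x ≠ Λ.flip (Λ.side a) := by rintro rfl; exact hxa hlab
        rw [and_iff_right hxa, and_iff_right hxb]
        rcases Λ.mem_positions.1 hy with rfl | hy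
        · rw [hlab]
          have hle : M.faceSetoid ≤ Setoid.comap Λ.label r := by
            rw [NonOrientedMap.faceSetoid_le_iff]
            exact fun x => ⟨(le_sup_left : Λ.cornerSetoid M.black ≤ _) (Λ.cornerSetoid_rel _ x),
              (le_sup_right : Λ.cornerSetoid M.white ≤ _) (Λ.cornerSetoid_rel _ x)⟩
          -- The label `a` is not an edge of `M`, so it is alone in its class for both vertex
          -- partitions.
          have hiso : ∀ f : X → X, (∀ z, z ∈ M.sides ↔ f z ∈ M.sides) →
              (∀ z, f z = z ↔ M.edge z = z) → Λ.cornerSetoid f ≤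
                Setoid.comap (· = a) ⟨Iff, ⟨Iff.refl, Iff.symm, Iff.trans⟩⟩ := by
            intro f hmem hfix
            rw [cornerSetoid_le_iff]
            intro z
            change Λ.label z = a ↔ Λ.label (f z) = a
            by_cases hz : Λ.label z ∈ l
            · have hfz := (hE.edge_ne_iff _).1 ((hmem z).1 ((hE.edge_ne_iff z).2 hz))
              exact ⟨fun h => absurd (h ▸ hz) ha, fun h => absurd (h ▸ hfz) ha⟩
            · rw [(hfix z).2 (hE.edge_eq hz)]
          have hle2 : r ≤ Setoid.comap (· = a) ⟨Iff, ⟨Iff.refl, Iff.symm, Iff.trans⟩⟩ :=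
            sup_le (hiso _ M.mem_sides_black M.black_eq_self_iff)
              (hiso _ M.mem_sides_white M.white_eq_self_iff)
          constructor
          · exact fun h => absurd ((hle2 h).2 rfl) hxa
          · intro h
            have h3 := hle h
            rw [Setoid.comap_rel, hlab] at h3
            exact absurd ((hle2 h3).2 rfl) hxa
        · exact (hE.faceSetoid_iff ht.isTopDegree hx hy).symm
      rw [← mul_assoc, h2, ← h1, add_mul]
      simp only [ite_mul, one_mul, zero_mul]
    have := Finset.sum_congr rfl hsum
    rw [Finset.sum_add_distrib, ← hflip, ← Finset.mul_sum] at this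
    linarith
  rw [Finset.sum_congr rfl hinner]
  have h1 : ∀ x, (∑ y ∈ Λ.positions a l, joinWeight a r (Λ.label x) (Λ.label y) *
      G (Λ.label x) (Λ.label y)) = (fun p => ∑ q ∈ (a :: l).toFinset,
        sideWeight a q * (joinWeight a r p q * G p q)) (Λ.label x) := fun x =>
    Λ.sum_positions ha fun q => joinWeight a r (Λ.label x) q * G (Λ.label x) q
  simp_rw [h1]
  rw [Λ.sum_positions ha fun p => ∑ q ∈ (a :: l).toFinset,
        sideWeight a q * (joinWeight a r p q * G p q)]
  refine Finset.sum_congr rfl fun p _ => ?_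
  rw [Finset.mul_sum]
  exact Finset.sum_congr rfl fun q _ => by ring

end Counting

end EdgeLabeling

/-! ### The recursion for pairs of permutations -/

open Classical in
/-- The permutations whose support is contained in `l`. -/
noncomputable def permsOn {Y : Type} [Fintype Y] (l : List Y) : Finset (Equiv.Perm Y) :=
  Finset.univ.filter fun σ => ∀ y ∉ l, σ y = y

theorem mem_permsOn {Y : Type} [Fintype Y] {l : List Y} {σ : Equiv.Perm Y} :
    σ ∈ permsOn l ↔ ∀ y ∉ l, σ y = y := by simp [permsOn]

-- A permutation supported on `a :: l` is determined by the image `p` of `a` and by what remains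
-- after `a` is cut out of its cycle; multiplying by `swap a p` performs the cut and undoes it.
open Classical in
theorem sum_permsOn_cons {Y : Type} [Fintype Y] {a : Y} {l : List Y} (ha : a ∉ l)
    (ψ : Setoid Y → ℚ) :
    ∑ σ ∈ permsOn (a :: l), ψ (Perm.SameCycle.setoid σ) =
      ∑ σ ∈ permsOn l, ∑ p ∈ (a :: l).toFinset, ψ (Perm.SameCycle.setoid σ ⊔ linkSetoid a p) := by
  rw [← Finset.sum_product']
  symm
  refine Finset.sum_nbij' (fun z => swap a z.2 * z.1) (fun σ => (swap a (σ a) * σ, σ a))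
    ?_ ?_ ?_ ?_ ?_
  · rintro ⟨σ, p⟩ h
    simp only [Finset.mem_product, mem_permsOn, List.mem_toFinset] at h ⊢
    intro y hy
    have h1 := h.1 y (fun h => hy (List.mem_cons_of_mem a h))
    rw [Perm.mul_apply, h1]
    refine swap_apply_of_ne_of_ne ?_ ?_
    · rintro rfl; exact hy List.mem_cons_self
    · rintro rfl; exact hy h.2
  · intro σ h
    simp only [Finset.mem_product, mem_permsOn, List.mem_toFinset] at h ⊢
    constructor
    · intro y hy
      rw [Perm.mul_apply]
      by_cases hya : y = a
      · rw [hya, swap_apply_right]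
      · have h1 := h y (by simp [hy, hya])
        rw [h1]
        refine swap_apply_of_ne_of_ne hya ?_
        intro h2
        exact hya (σ.injective (h1.trans h2))
    · by_contra hn
      exact hn (by
        have h1 := h _ hn
        rw [σ.injective h1]
        exact List.mem_cons_self)
  · rintro ⟨σ, p⟩ h
    simp only [Finset.mem_product, mem_permsOn, List.mem_toFinset] at h
    have h1 := h.1 a ha
    simp [h1, ← mul_assoc]
  · intro σ h
    simp [← mul_assoc]
  · rintro ⟨σ, p⟩ h
    simp only [Finset.mem_product, mem_permsOn] at h
    rw [Perm.sameCycle_setoid_swap_mul (h.1 a ha)]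

theorem eq_of_sup_sameCycle_setoid {Y : Type} {σ τ : Equiv.Perm Y} {a : Y} (hσ : σ a = a)
    (hτ : τ a = a) (y : Y) (h : (Perm.SameCycle.setoid σ ⊔ Perm.SameCycle.setoid τ) a y) :
    y = a := by
  have hle : ∀ σ : Equiv.Perm Y, σ a = a → Perm.SameCycle.setoid σ ≤
      Setoid.comap (· = a) ⟨Iff, ⟨Iff.refl, Iff.symm, Iff.trans⟩⟩ := by
    intro σ hσ
    rw [Perm.sameCycle_setoid_le_iff]
    intro x
    change x = a ↔ σ x = a
    exact ⟨fun h => h ▸ hσ, fun h => σ.injective (h.trans hσ.symm)⟩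
  exact ((sup_le (hle σ hσ) (hle τ hτ)) h).1 rfl

/-! ### Comparison of the two recursions -/

namespace EdgeLabeling

variable {Y X : Type} (Λ : EdgeLabeling Y X) [Fintype X]

theorem sum_topMaps_nil (φ : Setoid Y → Setoid Y → ℚ) :
    ∑ M ∈ Λ.topMaps [], φ (Λ.cornerSetoid M.black) (Λ.cornerSetoid M.white) = φ ⊥ ⊥ := by
  let E : NonOrientedMap X := ⟨id, id, id, fun _ => rfl, fun _ => rfl, fun _ => rfl,
    fun _ => Iff.rfl, fun _ => Iff.rfl⟩
  have hE : Λ.topMaps [] = {E} := by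
    ext M
    rw [mem_topMaps, Finset.mem_singleton, allTop_nil]
    constructor
    · rintro ⟨h, -⟩
      have h1 : ∀ x, M.edge x = x := fun x => h.edge_eq List.not_mem_nil
      exact NonOrientedMap.ext (funext fun x => (M.black_eq_self_iff x).2 (h1 x))
        (funext fun x => (M.white_eq_self_iff x).2 (h1 x)) (funext h1)
    · rintro rfl
      refine ⟨fun x => ⟨fun h => absurd h List.not_mem_nil, fun _ => rfl⟩, ?_⟩
      rw [NonOrientedMap.isTopDegree_iff_faceSetoid]
      exact fun x => Setoid.refl' _ x
  have hbot : Λ.cornerSetoid id = ⊥ :=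
    le_bot_iff.1 (Λ.cornerSetoid_le_iff.2 fun x => rfl)
  rw [hE, Finset.sum_singleton]
  change φ (Λ.cornerSetoid id) (Λ.cornerSetoid id) = _
  rw [hbot]

/-- For each order of the edges, the number of maps with a given underlying graph such that at each
step of the edge removal the number of faces is the number of connected components is, up to a power
of two, the number of oriented maps with this underlying graph. -/
theorem sum_perms_eq_sum_topMaps [Fintype Y] {l : List Y} (hl : l.Nodup) (φ : Setoid Y → Setoid Y → ℚ) :
    ∑ σ ∈ permsOn l, ∑ τ ∈ permsOn l,
      (1 / 2 : ℚ) ^ Nat.card (Quotient (Perm.SameCycle.setoid σ ⊔ Perm.SameCycle.setoid τ)) *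
        φ (Perm.SameCycle.setoid σ) (Perm.SameCycle.setoid τ) =
    (1 / 2) ^ Nat.card Y *
      ∑ M ∈ Λ.topMaps l, φ (Λ.cornerSetoid M.black) (Λ.cornerSetoid M.white) := by
  classical
  induction l generalizing φ with
  | nil =>
    have h1 : permsOn ([] : List Y) = {1} := by
      ext σ
      simp [mem_permsOn, Equiv.ext_iff]
    have h2 : Perm.SameCycle.setoid (1 : Perm Y) = ⊥ :=
      le_bot_iff.1 (Perm.sameCycle_setoid_le_iff.2 fun x => rfl)
    -- Labels that are not yet edges count as classes of their own: at the start there are `Nat.card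
    -- Y` of them, which is the source of the prefactor.
    rw [sum_topMaps_nil, h1, Finset.sum_singleton, Finset.sum_singleton, h2, sup_idem,
      card_quotient_bot]
  | cons a l ih =>
    obtain ⟨ha, hl⟩ := List.nodup_cons.1 hl
    rw [sum_topMaps_cons Λ ha]
    have hR : ∀ M ∈ Λ.topMaps l, (∑ x ∈ Λ.positions a l, ∑ y ∈ Λ.positions a l,
        if M.Joins (Λ.side a) (Λ.flip (Λ.side a)) x y then
          φ (Λ.cornerSetoid M.black ⊔ linkSetoid a (Λ.label x))
            (Λ.cornerSetoid M.white ⊔ linkSetoid a (Λ.label y)) else 0) =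
        (fun P Q => ∑ p ∈ (a :: l).toFinset, ∑ q ∈ (a :: l).toFinset,
          sideWeight a p * sideWeight a q * joinWeight a (P ⊔ Q) p q *
            φ (P ⊔ linkSetoid a p) (Q ⊔ linkSetoid a q))
          (Λ.cornerSetoid M.black) (Λ.cornerSetoid M.white) := fun M hM =>
      Λ.sum_joins ha hM (fun p q => φ (Λ.cornerSetoid M.black ⊔ linkSetoid a p)
        (Λ.cornerSetoid M.white ⊔ linkSetoid a q)) fun p q q' h => by
          rw [sup_link_congr h]
    -- The induction hypothesis is applied to the weighted sum over all attachments of `a`, again a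
    -- function of the two partitions; this is why `φ` must be arbitrary in the induction.
    rw [Finset.sum_congr rfl hR, ← ih hl fun P Q => ∑ p ∈ (a :: l).toFinset,
      ∑ q ∈ (a :: l).toFinset, sideWeight a p * sideWeight a q * joinWeight a (P ⊔ Q) p q *
        φ (P ⊔ linkSetoid a p) (Q ⊔ linkSetoid a q)]
    have h1 : ∀ σ : Perm Y, ∑ τ ∈ permsOn (a :: l),
        (1 / 2 : ℚ) ^ Nat.card (Quotient (Perm.SameCycle.setoid σ ⊔ Perm.SameCycle.setoid τ)) *
          φ (Perm.SameCycle.setoid σ) (Perm.SameCycle.setoid τ) =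
        (fun P => ∑ τ ∈ permsOn l, ∑ q ∈ (a :: l).toFinset,
          (1 / 2 : ℚ) ^ Nat.card (Quotient (P ⊔ (Perm.SameCycle.setoid τ ⊔ linkSetoid a q))) *
          φ P (Perm.SameCycle.setoid τ ⊔ linkSetoid a q)) (Perm.SameCycle.setoid σ) := fun σ =>
      sum_permsOn_cons ha fun Q => (1 / 2 : ℚ) ^ Nat.card (Quotient
        (Perm.SameCycle.setoid σ ⊔ Q)) * φ (Perm.SameCycle.setoid σ) Q
    simp_rw [h1]
    rw [sum_permsOn_cons ha fun P => ∑ τ ∈ permsOn l, ∑ q ∈ (a :: l).toFinset,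
          (1 / 2 : ℚ) ^ Nat.card (Quotient (P ⊔ (Perm.SameCycle.setoid τ ⊔ linkSetoid a q))) *
          φ P (Perm.SameCycle.setoid τ ⊔ linkSetoid a q)]
    refine Finset.sum_congr rfl fun σ hσ => ?_
    rw [Finset.sum_comm]
    refine Finset.sum_congr rfl fun τ hτ => ?_
    rw [Finset.mul_sum]
    refine Finset.sum_congr rfl fun p _ => ?_
    rw [Finset.mul_sum]
    refine Finset.sum_congr rfl fun q _ => ?_
    -- The four-fold join is regrouped so that both links are added to the common coarsening, where
    -- `a` is isolated because both permutations fix it.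
    rw [sup_sup_sup_comm, ← sup_assoc, half_pow_card_sup_links (fun y => eq_of_sup_sameCycle_setoid
      (mem_permsOn.1 hσ a ha) (mem_permsOn.1 hτ a ha) y) p q]
    ring

end EdgeLabeling

/-! ### From labeled to unlabeled maps -/

/-- The bicolored graph with edges `Y` whose vertices are the classes of two equivalence
relations. -/
def setoidGraph {Y : Type} (P Q : Setoid Y) : BicoloredGraph where
  Black := Quotient P
  White := Quotient Q
  Edge := Y
  blackEnd := Quotient.mk _
  whiteEnd := Quotient.mk _
  black_not_isolated := Quotient.mk_surjective
  white_not_isolated := Quotient.mk_surjective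

/-! ### Oriented maps -/

namespace OrientedMap

variable {X : Type}

/-- The orbits of the generated group are the classes of the join of the two cycle partitions, and
the recursion sees connectedness only through that join. -/
theorem isConnected_iff (M : OrientedMap X) :
    M.IsConnected ↔ Perm.SameCycle.setoid M.black ⊔ Perm.SameCycle.setoid M.white = ⊤ := by
  set H := (Subgroup.closure {M.white, M.black} : Subgroup (Equiv.Perm X))
  constructor
  · intro h
    set r := Perm.SameCycle.setoid M.black ⊔ Perm.SameCycle.setoid M.white
    have hb : ∀ x, r x (M.black x) :=
      Perm.sameCycle_setoid_le_iff.1 (le_sup_left : _ ≤ r)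
    have hw : ∀ x, r x (M.white x) :=
      Perm.sameCycle_setoid_le_iff.1 (le_sup_right : _ ≤ r)
    have key : ∀ g ∈ H, ∀ x, r x (g x) := by
      intro g hg
      induction hg using Subgroup.closure_induction with
      | mem g hg =>
        rcases hg with rfl | rfl
        exacts [hw, hb]
      | one => exact fun x => Setoid.refl' _ x
      | mul g g' _ _ ih ih' => exact fun x => Setoid.trans' _ (ih' x) (ih (g' x))
      | inv g _ ih =>
        intro x
        have := ih (g⁻¹ x)
        rw [← Perm.mul_apply, mul_inv_cancel, Perm.one_apply] at this
        exact Setoid.symm' _ this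
    refine top_le_iff.1 fun x y _ => ?_
    obtain ⟨⟨g, hg⟩, hxy⟩ := h.exists_smul_eq x y
    have := key g hg x
    rwa [show g x = y from hxy] at this
  · intro h
    refine ⟨fun x y => ?_⟩
    have hle : Perm.SameCycle.setoid M.black ⊔ Perm.SameCycle.setoid M.white ≤
        MulAction.orbitRel H X := by
      refine sup_le ?_ ?_ <;> rw [Perm.sameCycle_setoid_le_iff] <;> intro x
      · exact Setoid.symm' _ ⟨⟨M.black, Subgroup.subset_closure (by simp)⟩, rfl⟩
      · exact Setoid.symm' _ ⟨⟨M.white, Subgroup.subset_closure (by simp)⟩, rfl⟩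
    rw [h] at hle
    exact Setoid.symm' _ (hle (show (⊤ : Setoid X) x y from trivial))

/-- The map isomorphic to `M` by the relabeling `f`. -/
def conj (f : Perm X) (M : OrientedMap X) : OrientedMap X where
  white := f⁻¹ * M.white * f
  black := f⁻¹ * M.black * f

theorem isIso_iff_eq_conj {f : Perm X} {M N : OrientedMap X} : IsIso f N M ↔ N = M.conj f := by
  constructor
  · intro h
    ext x
    · simp [conj, h.white]
    · simp [conj, h.black]
  · rintro rfl
    exact ⟨fun x => by simp [conj], fun x => by simp [conj]⟩

theorem IsIso.isConnected {f : Perm X} {M N : OrientedMap X} (h : IsIso f N M)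
    (hM : M.IsConnected) : N.IsConnected := by
  rw [isConnected_iff] at hM ⊢
  set r := Perm.SameCycle.setoid N.black ⊔ Perm.SameCycle.setoid N.white
  have hb : ∀ x, r x (N.black x) := Perm.sameCycle_setoid_le_iff.1 (le_sup_left : _ ≤ r)
  have hw : ∀ x, r x (N.white x) := Perm.sameCycle_setoid_le_iff.1 (le_sup_right : _ ≤ r)
  have hle : Perm.SameCycle.setoid M.black ⊔ Perm.SameCycle.setoid M.white ≤
      Setoid.comap f.symm r := by
    refine sup_le ?_ ?_ <;> rw [Perm.sameCycle_setoid_le_iff] <;> intro x <;>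
      rw [Setoid.comap_rel]
    · have h1 := h.black (f.symm x)
      rw [apply_symm_apply] at h1
      rw [h1, symm_apply_apply]
      exact hb _
    · have h1 := h.white (f.symm x)
      rw [apply_symm_apply] at h1
      rw [h1, symm_apply_apply]
      exact hw _
  rw [hM] at hle
  refine top_le_iff.1 fun x y _ => ?_
  have := hle (show (⊤ : Setoid X) (f x) (f y) from trivial)
  rwa [Setoid.comap_rel, symm_apply_apply, symm_apply_apply] at this

/-- Agreement at an edge propagates along both permutations, hence everywhere by connectedness. So a
rooted connected map has no nontrivial automorphism. -/
theorem IsIso.eq_of_isConnected {f g : Perm X} {M N : OrientedMap X} (hf : IsIso f N M)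
    (hg : IsIso g N M) (hN : N.IsConnected) {x : X} (hx : f x = g x) : f = g := by
  rw [isConnected_iff] at hN
  have hle : Perm.SameCycle.setoid N.black ⊔ Perm.SameCycle.setoid N.white ≤
      Setoid.comap (fun x => f x = g x) ⟨Iff, ⟨Iff.refl, Iff.symm, Iff.trans⟩⟩ := by
    refine sup_le ?_ ?_ <;> rw [Perm.sameCycle_setoid_le_iff] <;> intro x
    · change f x = g x ↔ f (N.black x) = g (N.black x)
      rw [← hf.black, ← hg.black, M.black.injective.eq_iff]
    · change f x = g x ↔ f (N.white x) = g (N.white x)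
      rw [← hf.white, ← hg.white, M.white.injective.eq_iff]
  rw [hN] at hle
  ext y
  exact (hle (show (⊤ : Setoid X) x y from trivial)).1 hx

end OrientedMap

/-- Relabelings act freely by rigidity, so the labelings of one rooted map are a single free orbit
of the symmetric group. -/
theorem card_fiber_rootedOrientedMap {n : ℕ} (κ : RootedOrientedMap n) :
    Nat.card {N : LabeledRootedOrientedMap n // (Quotient.mk _ N : RootedOrientedMap n) = κ} =
      n.factorial := by
  induction κ using Quotient.ind with
  | _ M =>
  have hfact : Nat.card (Perm (Fin n)) = n.factorial := by
    rw [Nat.card_eq_fintype_card, Fintype.card_perm, Fintype.card_fin]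
  rw [← hfact]
  have hiso : ∀ f : Perm (Fin n), OrientedMap.IsIso f (M.map.conj f) M.map :=
    fun f => OrientedMap.isIso_iff_eq_conj.2 rfl
  symm
  refine Nat.card_eq_of_bijective (fun f => ⟨⟨M.map.conj f, f.symm M.root,
    (hiso f).isConnected M.connected⟩, Quotient.sound ⟨f, hiso f, f.apply_symm_apply _⟩⟩) ⟨?_, ?_⟩
  · intro f g h
    simp only [Subtype.mk.injEq, LabeledRootedOrientedMap.mk.injEq] at h
    refine (hiso f).eq_of_isConnected (h.1 ▸ hiso g) ((hiso f).isConnected M.connected)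
      (x := f.symm M.root) ?_
    rw [apply_symm_apply, h.2, apply_symm_apply]
  · rintro ⟨⟨N, r, hN⟩, h⟩
    obtain ⟨f, hf, hr⟩ := Quotient.exact h
    refine ⟨f, Subtype.ext ?_⟩
    simp only [LabeledRootedOrientedMap.mk.injEq]
    exact ⟨(OrientedMap.isIso_iff_eq_conj.1 hf).symm, by rw [← hr]; exact f.symm_apply_apply r⟩

theorem sum_fiber_card {A B : Type} [Fintype A] [Fintype B] (π : A → B) (F : B → ℚ) :
    ∑ a, F (π a) = ∑ b, (Nat.card {a // π a = b} : ℚ) * F b := by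
  classical
  rw [← Finset.sum_fiberwise' Finset.univ π F]
  refine Finset.sum_congr rfl fun b _ => ?_
  rw [Finset.sum_const, nsmul_eq_mul, Nat.card_eq_fintype_card, Fintype.card_subtype]

-- The factor `n!` counts labelings of a rooted class, the factor `n` the choices of root for a
-- labeled map.
open Classical in
theorem sum_rootedOrientedMap (n : ℕ) (g : UnlabeledGraph → ℚ) :
    (n.factorial : ℚ) * ∑ κ : RootedOrientedMap n, g κ.graph =
      n * ∑ σ : Perm (Fin n), ∑ τ : Perm (Fin n),
        if Perm.SameCycle.setoid σ ⊔ Perm.SameCycle.setoid τ = ⊤ then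
          g (Quotient.mk _ (setoidGraph (Perm.SameCycle.setoid σ) (Perm.SameCycle.setoid τ)))
        else 0 := by
  let _ : Fintype (LabeledRootedOrientedMap n) := Fintype.ofFinite _
  have h1 := sum_fiber_card (fun N : LabeledRootedOrientedMap n =>
    (Quotient.mk _ N : RootedOrientedMap n)) fun κ : RootedOrientedMap n => g κ.graph
  simp_rw [card_fiber_rootedOrientedMap] at h1
  rw [Finset.mul_sum, ← h1, ← Finset.sum_product', Finset.univ_product_univ, ← Finset.sum_filter,
    ← nsmul_eq_mul, ← Finset.sum_nsmul]
  have h2 : ∀ z : Perm (Fin n) × Perm (Fin n), n •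
      g (Quotient.mk _ (setoidGraph (Perm.SameCycle.setoid z.1) (Perm.SameCycle.setoid z.2))) =
      ∑ _r : Fin n,
        g (Quotient.mk _ (setoidGraph (Perm.SameCycle.setoid z.1) (Perm.SameCycle.setoid z.2))) := by
    intro z
    rw [Finset.sum_const, Finset.card_univ, Fintype.card_fin]
  simp_rw [h2]
  rw [← Finset.sum_product']
  refine Finset.sum_bij (fun N _ => ((N.map.black, N.map.white), N.root)) ?_ ?_ ?_ ?_
  · intro N _
    simpa using N.map.isConnected_iff.1 N.connected
  · rintro ⟨⟨w, b⟩, r, _⟩ _ ⟨⟨w', b'⟩, r', _⟩ _ h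
    simp only [Prod.mk.injEq] at h
    obtain ⟨⟨rfl, rfl⟩, rfl⟩ := h
    rfl
  · rintro ⟨⟨b, w⟩, r⟩ h
    simp only [Finset.mem_product, Finset.mem_filter, Finset.mem_univ, true_and, and_true] at h
    exact ⟨⟨⟨w, b⟩, r, (OrientedMap.isConnected_iff _).2 h⟩, Finset.mem_univ _, rfl⟩
  · intro N _
    rfl

namespace NonOrientedMap

variable {X : Type}

/-- The map isomorphic to `M` by the relabeling `f`. -/
def conj (f : Perm X) (M : NonOrientedMap X) : NonOrientedMap X where
  black x := f.symm (M.black (f x))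
  white x := f.symm (M.white (f x))
  edge x := f.symm (M.edge (f x))
  black_involutive x := by simp [M.black_involutive _]
  white_involutive x := by simp [M.white_involutive _]
  edge_involutive x := by simp [M.edge_involutive _]
  black_eq_self_iff x := by simp [symm_apply_eq, M.black_eq_self_iff]
  white_eq_self_iff x := by simp [symm_apply_eq, M.white_eq_self_iff]

theorem isIso_iff_eq_conj {f : Perm X} {M N : NonOrientedMap X} :
    IsIso f N M ↔ N = M.conj f := by
  constructor
  · intro h
    ext x
    · simp [conj, h.black]
    · simp [conj, h.white]
    · simp [conj, h.edge]
  · rintro rfl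
    exact ⟨fun x => by simp [conj], fun x => by simp [conj], fun x => by simp [conj]⟩

theorem card_face_eq_one_iff [Nonempty X] {M : NonOrientedMap X} (hM : M.sides = Set.univ) :
    Nat.card M.Face = 1 ↔ M.faceSetoid = ⊤ := by
  have hmem : ∀ x, x ∈ M.sides := fun x => hM ▸ Set.mem_univ x
  rw [Nat.card_eq_one_iff_unique]
  constructor
  · rintro ⟨h, -⟩
    refine top_le_iff.1 fun x y _ => ?_
    exact (M.face_mk_eq_iff ⟨x, hmem x⟩ ⟨y, hmem y⟩).1 (h.elim _ _)
  · intro h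
    refine ⟨⟨?_⟩, ⟨Quot.mk _ ⟨Classical.arbitrary X, hmem _⟩⟩⟩
    rintro ⟨x⟩ ⟨y⟩
    refine (M.face_mk_eq_iff x y).2 ?_
    rw [h]
    trivial

/-- The same rigidity, propagated around the single face by `black` and `white` alone. -/
theorem IsIso.eq_of_faceSetoid_eq_top {f g : Perm X} {M N : NonOrientedMap X} (hf : IsIso f N M)
    (hg : IsIso g N M) (hN : N.faceSetoid = ⊤) {x : X} (hx : f x = g x) : f = g := by
  have hle : N.faceSetoid ≤
      Setoid.comap (fun x => f x = g x) ⟨Iff, ⟨Iff.refl, Iff.symm, Iff.trans⟩⟩ := by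
    rw [faceSetoid_le_iff]
    intro x
    constructor
    · change f x = g x ↔ f (N.black x) = g (N.black x)
      rw [← hf.black, ← hg.black, M.black_involutive.injective.eq_iff]
    · change f x = g x ↔ f (N.white x) = g (N.white x)
      rw [← hf.white, ← hg.white, M.white_involutive.injective.eq_iff]
  rw [hN] at hle
  ext y
  exact (hle (show (⊤ : Setoid X) x y from trivial)).1 hx

theorem IsIso.sides_eq_univ {f : Perm X} {M N : NonOrientedMap X} (h : IsIso f N M)
    (hM : M.sides = Set.univ) : N.sides = Set.univ :=
  Set.eq_univ_of_forall fun x => (h.mem_sides x).2 (hM ▸ Set.mem_univ _)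

theorem edge_mk_eq_iff (M : NonOrientedMap X) (x y : M.sides) :
    (Quot.mk _ x : M.Edge) = Quot.mk _ y ↔ (y : X) = x ∨ (y : X) = M.edge x := by
  constructor
  · intro h
    have hx := M.side_mk x
    have hy := M.side_mk y
    rw [h] at hx
    have h1 := M.edge_involutive x
    have h2 := M.edge_involutive y
    grind
  · rintro (h | h)
    · rw [Subtype.ext h]
    · exact Quot.sound h

theorem Edge.side_mem {M : NonOrientedMap X} (e : M.Edge) : e.side ∈ M.sides :=
  (Quot.out e : M.sides).2

theorem Edge.mk_side {M : NonOrientedMap X} (e : M.Edge) :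
    (Quot.mk _ ⟨e.side, e.side_mem⟩ : M.Edge) = e :=
  Quot.out_eq e

end NonOrientedMap

namespace EdgeLabeling

variable {Y X : Type} (Λ : EdgeLabeling Y X)

theorem sides_eq_univ {Λ : EdgeLabeling Y X} {M : NonOrientedMap X}
    (hE : ∀ x, M.edge x = Λ.flip x) : M.sides = Set.univ :=
  Set.eq_univ_of_forall fun x => by
    change M.edge x ≠ x
    rw [hE]
    exact Λ.flip_ne x

/-- The vertices of one color, described in terms of edge-sides and in terms of edges. -/
theorem exists_vertexEquiv {M : NonOrientedMap X} (hE : ∀ x, M.edge x = Λ.flip x) (f : X → X) :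
    ∃ e : Quot (fun x y : M.sides => (y : X) = f x ∨ (y : X) = M.edge x) ≃
      Quotient (Λ.cornerSetoid f), ∀ x, e (Quot.mk _ x) = Quotient.mk _ (Λ.label x) := by
  have hmem : ∀ x, x ∈ M.sides := fun x => sides_eq_univ hE ▸ Set.mem_univ x
  have hlab : ∀ x y : X, Λ.label x = Λ.label y →
      Quot.mk (fun x y : M.sides => (y : X) = f x ∨ (y : X) = M.edge x) ⟨x, hmem x⟩ =
        Quot.mk _ ⟨y, hmem y⟩ := by
    intro x y h
    rcases (Λ.label_eq_iff _ _).1 h with rfl | h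
    · rfl
    · exact Quot.sound (Or.inr (by rw [hE]; exact h))
  refine ⟨⟨Quot.lift (fun x => Quotient.mk _ (Λ.label x)) ?_,
    Quotient.lift (fun y => Quot.mk _ ⟨Λ.side y, hmem _⟩) ?_, ?_, ?_⟩, fun x => rfl⟩
  · rintro x y (h | h) <;> rw [h]
    · exact Quotient.sound (Λ.cornerSetoid_rel f x)
    · rw [hE, Λ.label_flip]
  · intro u v huv
    have hle : Λ.cornerSetoid f ≤ Setoid.ker (fun y =>
        Quot.mk (fun x y : M.sides => (y : X) = f x ∨ (y : X) = M.edge x)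
          ⟨Λ.side y, hmem _⟩) := by
      rw [cornerSetoid_le_iff]
      intro x
      rw [Setoid.ker_def, hlab _ x (Λ.label_side _), hlab _ (f x) (Λ.label_side _)]
      exact Quot.sound (Or.inl rfl)
    exact hle huv
  · rintro ⟨x⟩
    exact hlab _ _ (Λ.label_side _)
  · rintro ⟨y⟩
    change Quotient.mk _ (Λ.label (Λ.side y)) = _
    rw [Λ.label_side]
    rfl

theorem graph_isomorphic_setoidGraph {M : NonOrientedMap X} (hE : ∀ x, M.edge x = Λ.flip x) :
    M.graph.Isomorphic
      (setoidGraph (Λ.cornerSetoid M.black) (Λ.cornerSetoid M.white)) := by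
  have hmem : ∀ x, x ∈ M.sides := fun x => sides_eq_univ hE ▸ Set.mem_univ x
  obtain ⟨b, hb⟩ := Λ.exists_vertexEquiv hE M.black
  obtain ⟨w, hw⟩ := Λ.exists_vertexEquiv hE M.white
  let e : M.Edge ≃ Y :=
    { toFun := Quot.lift (fun x => Λ.label x) fun x y h => by rw [h, hE, Λ.label_flip]
      invFun := fun y => Quot.mk _ ⟨Λ.side y, hmem _⟩
      left_inv := by
        rintro ⟨x⟩
        refine (M.edge_mk_eq_iff _ _).2 ?_
        rw [hE, ← Λ.label_eq_iff]
        exact Λ.label_side _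
      right_inv := fun y => Λ.label_side y }
  refine ⟨b, w, e, ?_, ?_⟩
  · rintro ⟨x⟩
    exact (hb x).symm
  · rintro ⟨x⟩
    exact (hw x).symm

/-! ### Histories and labelings of the edges -/

section Histories

variable {M : NonOrientedMap X}

open Classical in
/-- The relabeling that carries the edge `y` to the edge `e y`; the carrying of its two sides is
prescribed by `s`. -/
noncomputable def relabelFun (e : Y → M.Edge) (s : Y → Bool) (x : X) : X :=
  if (x = Λ.side (Λ.label x) ↔ s (Λ.label x) = true) then (e (Λ.label x)).side
  else M.edge (e (Λ.label x)).side

theorem relabelFun_flip (e : Y → M.Edge) (s : Y → Bool) (x : X) :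
    Λ.relabelFun e s (Λ.flip x) = M.edge (Λ.relabelFun e s x) := by
  have h1 : Λ.flip x = Λ.side (Λ.label x) ↔ ¬ x = Λ.side (Λ.label x) := by
    have h2 := Λ.eq_of_label_eq (x := x) rfl
    have h3 := Λ.flip_flip x
    have h4 := Λ.flip_flip (Λ.side (Λ.label x))
    have h5 := Λ.flip_ne x
    grind
  have h6 := M.edge_involutive (e (Λ.label x)).side
  unfold relabelFun
  rw [Λ.label_flip]
  grind

theorem relabelFun_eq_or (e : Y → M.Edge) (s : Y → Bool) (x : X) :
    Λ.relabelFun e s x = (e (Λ.label x)).side ∨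
      Λ.relabelFun e s x = M.edge (e (Λ.label x)).side := by
  unfold relabelFun
  split_ifs <;> simp

theorem edge_eq_of_side {e e' : M.Edge} {t : X} (h : t = e.side ∨ t = M.edge e.side)
    (h' : t = e'.side ∨ t = M.edge e'.side) : e = e' := by
  rw [← e.mk_side, ← e'.mk_side]
  refine (M.edge_mk_eq_iff _ _).2 ?_
  have h1 := M.edge_involutive e.side
  have h2 := M.edge_involutive e'.side
  grind

theorem relabelFun_injective {e : Y → M.Edge} (he : Function.Injective e) (s : Y → Bool)
    (hM : M.sides = Set.univ) : Function.Injective (Λ.relabelFun e s) := by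
  intro x z h
  have h1 := edge_eq_of_side (Λ.relabelFun_eq_or e s x) (h ▸ Λ.relabelFun_eq_or e s z)
  rcases (Λ.label_eq_iff _ _).1 (he h1) with hz | rfl
  · exact hz.symm
  · rw [relabelFun_flip] at h
    have : Λ.relabelFun e s x ∈ M.sides := hM ▸ Set.mem_univ _
    exact absurd h.symm this

/-- The relabelings compatible with the pairings of the sides of the edges are in bijection with the
pairs formed by a labeling of the edges and a choice of a side for each edge. -/
theorem exists_relabelEquiv [Finite X] (hM : M.sides = Set.univ) :
    ∃ E : (Y ≃ M.Edge) × (Y → Bool) ≃ {f : Perm X // ∀ x, f (Λ.flip x) = M.edge (f x)},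
      ∀ z y, (z.1 y).side = (E z).1 (Λ.side y) ∨ (z.1 y).side = M.edge ((E z).1 (Λ.side y)) := by
  have hmem : ∀ x, x ∈ M.sides := fun x => hM ▸ Set.mem_univ x
  let F : (Y ≃ M.Edge) × (Y → Bool) → {f : Perm X // ∀ x, f (Λ.flip x) = M.edge (f x)} := fun z =>
    ⟨Equiv.ofBijective (Λ.relabelFun z.1 z.2)
      (Finite.injective_iff_bijective.1 (Λ.relabelFun_injective z.1.injective z.2 hM)),
      Λ.relabelFun_flip z.1 z.2⟩
  have hFapp : ∀ z x, (F z).1 x = Λ.relabelFun z.1 z.2 x := fun z x => rfl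
  have hF : Function.Bijective F := by
    constructor
    · rintro ⟨e, s⟩ ⟨e', s'⟩ h
      have hfun : ∀ x, Λ.relabelFun e s x = Λ.relabelFun e' s' x := by
        intro x
        rw [← hFapp (e, s), h, hFapp]
      have he : e = e' := by
        ext y
        have h1 := Λ.relabelFun_eq_or e s (Λ.side y)
        have h2 := Λ.relabelFun_eq_or e' s' (Λ.side y)
        rw [← hfun] at h2
        rw [Λ.label_side] at h1 h2
        exact edge_eq_of_side h1 h2
      subst he
      have hs : s = s' := by
        ext y
        have h1 := hfun (Λ.side y)
        have h2 : M.edge (e y).side ≠ (e y).side := hmem _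
        unfold relabelFun at h1
        rw [Λ.label_side] at h1
        grind
      rw [hs]
    · rintro ⟨f, hf⟩
      -- A compatible relabeling carries pairs of sides to pairs of sides and so induces a bijection
      -- of edges; the Boolean records whether the chosen side goes to the chosen side.
      let e : Y → M.Edge := fun y => Quot.mk _ ⟨f (Λ.side y), hmem _⟩
      have he : Function.Bijective e := by
        constructor
        · intro y y' h
          have h1 := (M.edge_mk_eq_iff _ _).1 h
          simp only at h1
          rw [← hf, f.injective.eq_iff, f.injective.eq_iff, ← Λ.label_eq_iff, Λ.label_side,
            Λ.label_side] at h1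
          exact h1
        · rintro ⟨⟨x, hx⟩⟩
          refine ⟨Λ.label (f.symm x), (M.edge_mk_eq_iff _ _).2 ?_⟩
          simp only
          rw [← hf, ← symm_apply_eq, ← symm_apply_eq, ← Λ.label_eq_iff, Λ.label_side]
      classical
      refine ⟨(Equiv.ofBijective e he, fun y => decide (f (Λ.side y) = (e y).side)), ?_⟩
      refine Subtype.ext (Equiv.ext fun x => ?_)
      rw [hFapp]
      have h1 : ∀ y, Λ.relabelFun e (fun y => decide (f (Λ.side y) = (e y).side)) (Λ.side y) =
          f (Λ.side y) := by
        intro y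
        have h2 := M.side_mk ⟨f (Λ.side y), hmem _⟩
        have h3 : e y = Quot.mk _ ⟨f (Λ.side y), hmem _⟩ := rfl
        rw [← h3] at h2
        have h4 := M.edge_involutive (f (Λ.side y))
        unfold relabelFun
        rw [Λ.label_side]
        simp only [true_iff, decide_eq_true_eq]
        grind
      change Λ.relabelFun e (fun y => decide (f (Λ.side y) = (e y).side)) x = f x
      rcases Λ.eq_of_label_eq (x := x) rfl with hx | hx <;> rw [hx]
      · exact h1 _
      · rw [relabelFun_flip, h1, hf]
  refine ⟨Equiv.ofBijective F hF, fun z y => ?_⟩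
  have h1 := Λ.relabelFun_eq_or z.1 z.2 (Λ.side y)
  rw [Λ.label_side] at h1
  have h2 := M.edge_involutive (z.1 y).side
  change _ = Λ.relabelFun z.1 z.2 (Λ.side y) ∨ _ = M.edge (Λ.relabelFun z.1 z.2 (Λ.side y))
  grind

end Histories

end EdgeLabeling

namespace NonOrientedMap

variable {X : Type}

/-- The labeling of the edges of a map by themselves. -/
noncomputable def edgeLabeling (M : NonOrientedMap X) (hM : M.sides = Set.univ) :
    EdgeLabeling M.Edge X where
  label x := Quot.mk _ ⟨x, hM ▸ Set.mem_univ x⟩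
  side e := e.side
  flip := M.edge
  flip_flip := M.edge_involutive
  flip_ne x := (hM ▸ Set.mem_univ x : x ∈ M.sides)
  label_side e := e.mk_side
  label_eq_iff _ _ := M.edge_mk_eq_iff _ _

end NonOrientedMap

theorem List.Nodup.exists_equiv_map_eq {A B : Type} {l : List A} {m : List B} (hl : l.Nodup)
    (hl' : ∀ a, a ∈ l) (hm : m.Nodup) (hm' : ∀ b, b ∈ m) (h : l.length = m.length) :
    ∃ e : A ≃ B, l.map e = m := by
  classical
  refine ⟨((hl.getEquivOfForallMemList l hl').symm.trans (finCongr h)).trans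
    (hm.getEquivOfForallMemList m hm'), ?_⟩
  refine List.ext_getElem (by simpa using h) fun i h1 h2 => ?_
  have h3 : (hl.getEquivOfForallMemList l hl').symm l[i] = ⟨i, by simpa using h1⟩ := by
    rw [symm_apply_eq]
    rfl
  rw [List.getElem_map, trans_apply, trans_apply, h3]
  rfl

namespace EdgeLabeling

variable {Y X : Type} (Λ : EdgeLabeling Y X)

theorem card_eq_two_mul (Λ : EdgeLabeling Y X) : Nat.card X = 2 * Nat.card Y := by
  have hbij : Function.Bijective fun z : Bool × Y =>
      if z.1 = true then Λ.side z.2 else Λ.flip (Λ.side z.2) := by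
    constructor
    · rintro ⟨s, y⟩ ⟨s', y'⟩ h
      have h1 := congrArg Λ.label h
      have h2 := Λ.flip_ne (Λ.side y)
      have hy : y = y' := by
        rw [apply_ite Λ.label, apply_ite Λ.label] at h1
        simpa only [Λ.label_flip, Λ.label_side, ite_self] using h1
      subst hy
      cases s <;> cases s' <;> simp_all [eq_comm]
    · intro x
      rcases Λ.eq_of_label_eq (x := x) rfl with hx | hx
      · exact ⟨(true, Λ.label x), by simpa using hx.symm⟩
      · exact ⟨(false, Λ.label x), by simpa using hx.symm⟩
  rw [← Nat.card_eq_of_bijective _ hbij, Nat.card_prod, Nat.card_eq_fintype_card (α := Bool),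
    Fintype.card_bool]

section Histories

variable {M : NonOrientedMap X} {l : List Y}

/-- The history of `M` in which the edges are ordered by the list `l` of their labels. -/
def historyOfEquiv (hl : l.Nodup) (hl' : ∀ y, y ∈ l) (e : Y ≃ M.Edge) : M.History :=
  ⟨l.map e, (List.nodup_map_iff e.injective).2 hl,
    fun x => List.mem_map.2 ⟨e.symm x, hl' _, e.apply_symm_apply x⟩⟩

/-- With `l` fixed, ordering the edges of `M` amounts to labeling them; the label set and the edge
set both have half the cardinality of `X`. -/
theorem historyOfEquiv_bijective (Λ : EdgeLabeling Y X) (hl : l.Nodup) (hl' : ∀ y, y ∈ l)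
    (hM : M.sides = Set.univ) :
    Function.Bijective (historyOfEquiv hl hl' : (Y ≃ M.Edge) → M.History) := by
  have hlen : ∀ {A : Type} {m : List A}, m.Nodup → (∀ a, a ∈ m) → m.length = Nat.card A := by
    intro A m hm hm'
    classical
    rw [Nat.card_congr (hm.getEquivOfForallMemList m hm').symm, Nat.card_fin]
  constructor
  · intro e e' h
    have h1 : l.map e = l.map e' := congrArg Subtype.val h
    ext y
    exact List.map_inj_left.1 h1 y (hl' y)
  · rintro ⟨m, hm, hm'⟩
    have h1 := Λ.card_eq_two_mul
    rw [(M.edgeLabeling hM).card_eq_two_mul] at h1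
    obtain ⟨e, he⟩ := hl.exists_equiv_map_eq hl' hm hm' (by rw [hlen hl hl', hlen hm hm']; omega)
    exact ⟨e, Subtype.ext he⟩

/-- Removing edges in label order after relabeling is removing them in the order of the history; the
relabeling may pick the other side of an edge, which does not affect removal. -/
theorem allTop_conj_iff (hl : l.Nodup) (hl' : ∀ y, y ∈ l) (f : Perm X) (e : Y ≃ M.Edge)
    (hfe : ∀ y, (e y).side = f (Λ.side y) ∨ (e y).side = M.edge (f (Λ.side y))) :
    Λ.AllTop (M.conj f) l ↔ (historyOfEquiv hl hl' e).IsTopDegree := by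
  have hiso : NonOrientedMap.IsIso f (M.conj f) M := NonOrientedMap.isIso_iff_eq_conj.2 rfl
  have hst : ∀ i, ((M.conj f).removeEdges ((l.take i).map Λ.side)).IsTopDegree ↔
      ((historyOfEquiv hl hl' e).stage i).IsTopDegree := by
    intro i
    have h1 := (hiso.removeEdges ((l.take i).map Λ.side)).isTopDegree_iff
    have h2 : (historyOfEquiv hl hl' e).stage i =
        M.removeEdges (((l.take i).map Λ.side).map f) := by
      refine (NonOrientedMap.removeEdges_congr M.edge M.edge_involutive M (fun x => Or.inl rfl)
        ?_).symm
      change List.Forall₂ _ _ (List.map _ (List.take i (l.map e)))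
      rw [← List.map_take, List.map_map, List.map_map, List.forall₂_map_left_iff,
        List.forall₂_map_right_iff, List.forall₂_same]
      exact fun y _ => hfe y
    rw [h2]
    exact h1
  unfold NonOrientedMap.History.IsTopDegree AllTop
  rw [show (historyOfEquiv hl hl' e).1.length = l.length from List.length_map _]
  exact forall_congr' fun i => forall_congr' fun _ => hst i

theorem hasEdges_conj_iff (hl' : ∀ y, y ∈ l) (f : Perm X) :
    Λ.HasEdges (M.conj f) l ↔ ∀ x, f (Λ.flip x) = M.edge (f x) := by
  simp only [HasEdges, hl', not_true, false_implies, and_true, forall_const,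
    NonOrientedMap.conj, symm_apply_eq]
  exact forall_congr' fun x => eq_comm

/-- A relabeling onto the standard edges is a history together with a choice of side for each edge.
There are `(Nat.card Y)!` histories, so the number of top-degree ones is that times `monTop`: the
uniform random order becomes a count for one fixed order. -/
theorem card_relabelings [Finite X] [Finite Y] (hl : l.Nodup) (hl' : ∀ y, y ∈ l)
    (hM : M.sides = Set.univ) :
    (Nat.card {f : Perm X // Λ.HasEdges (M.conj f) l ∧ Λ.AllTop (M.conj f) l} : ℚ) =
      2 ^ Nat.card Y * (Nat.card Y).factorial * M.monTop := by
  classical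
  obtain ⟨E, hE⟩ := Λ.exists_relabelEquiv (M := M) hM
  have h1 := Λ.historyOfEquiv_bijective hl hl' hM
  let H : (Y ≃ M.Edge) ≃ M.History := Equiv.ofBijective _ h1
  let E' : {z : (Y ≃ M.Edge) × (Y → Bool) // (H z.1).IsTopDegree} ≃
      {f : {f : Perm X // ∀ x, f (Λ.flip x) = M.edge (f x)} // Λ.AllTop (M.conj f.1) l} :=
    E.subtypeEquiv fun z => (Λ.allTop_conj_iff hl hl' (E z).1 z.1 (hE z)).symm
  let E'' : {f : Perm X // Λ.HasEdges (M.conj f) l ∧ Λ.AllTop (M.conj f) l} ≃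
      {f : {f : Perm X // ∀ x, f (Λ.flip x) = M.edge (f x)} // Λ.AllTop (M.conj f.1) l} :=
    (Equiv.subtypeEquivRight fun f => and_congr_left' (Λ.hasEdges_conj_iff hl' f)).trans
      (Equiv.subtypeSubtypeEquivSubtypeInter _ fun f => Λ.AllTop (M.conj f) l).symm
  let E3 : {z : (Y ≃ M.Edge) × (Y → Bool) // (H z.1).IsTopDegree} ≃
      {h : M.History // h.IsTopDegree} × (Y → Bool) :=
    (Equiv.prodSubtypeFstEquivSubtypeProd (p := fun e => (H e).IsTopDegree)).trans
      (Equiv.prodCongr (H.subtypeEquiv fun e => Iff.rfl) (Equiv.refl _))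
  have hbool : Nat.card (Y → Bool) = 2 ^ Nat.card Y := by
    rw [Nat.card_fun, Nat.card_eq_fintype_card (α := Bool), Fintype.card_bool]
  have hcardE : Nat.card Y = Nat.card M.Edge := by
    have h1 := Λ.card_eq_two_mul
    rw [(M.edgeLabeling hM).card_eq_two_mul] at h1
    omega
  have hhist : Nat.card M.History = (Nat.card Y).factorial := by
    have : Finite M.Edge := Finite.of_surjective (Quot.mk _) Quot.mk_surjective
    obtain ⟨e⟩ := (Finite.card_eq (α := Y) (β := M.Edge)).1 hcardE
    rw [← Nat.card_congr H, Nat.card_congr (Equiv.equivCongr (Equiv.refl Y) e.symm), Nat.card_perm]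
  rw [Nat.card_congr ((E''.trans E'.symm).trans E3), Nat.card_prod, hbool,
    NonOrientedMap.monTop, hhist]
  have : ((Nat.card Y).factorial : ℚ) ≠ 0 := by exact_mod_cast Nat.factorial_ne_zero _
  push_cast
  field_simp

end Histories

end EdgeLabeling

/-- The labeling of the edges with the edge-sides `Fin (2 * n)`. -/
def finEdgeLabeling (n : ℕ) : EdgeLabeling (Fin n) (Fin (2 * n)) where
  label x := (finProdFinEquiv.symm x).2
  side y := finProdFinEquiv (0, y)
  flip x := finProdFinEquiv ((finProdFinEquiv.symm x).1 + 1, (finProdFinEquiv.symm x).2)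
  flip_flip x := by
    rw [symm_apply_apply, ← Equiv.eq_symm_apply]
    generalize finProdFinEquiv.symm x = z
    rcases z with ⟨s, y⟩
    fin_cases s <;> rfl
  flip_ne x := by
    rw [ne_eq, ← Equiv.eq_symm_apply]
    generalize finProdFinEquiv.symm x = z
    rcases z with ⟨s, y⟩
    fin_cases s <;> simp
  label_side y := by rw [symm_apply_apply]
  label_eq_iff x z := by
    obtain ⟨⟨s, y⟩, rfl⟩ := finProdFinEquiv.surjective x
    obtain ⟨⟨s', y'⟩, rfl⟩ := finProdFinEquiv.surjective z
    rw [finProdFinEquiv.injective.eq_iff, finProdFinEquiv.injective.eq_iff, symm_apply_apply,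
      symm_apply_apply]
    fin_cases s <;> fin_cases s' <;> simp [eq_comm]

/-! ### Rooted one-face maps with standard edge labels -/

section OneFace

variable {n : ℕ}

/-- The labeled maps with one face and with the standard labels of the edges, for which at each step
of the removal of the edges in the order of their labels the number of faces is the number of
connected components. -/
def StandardOneFaceMap (n : ℕ) : Type :=
  {M : NonOrientedMap (Fin (2 * n)) // ((finEdgeLabeling n).HasEdges M (List.finRange n) ∧
    (finEdgeLabeling n).AllTop M (List.finRange n)) ∧ Nat.card M.Face = 1}

namespace StandardOneFaceMap

instance : Finite (StandardOneFaceMap n) := Subtype.finite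

theorem edge_eq (M : StandardOneFaceMap n) (x : Fin (2 * n)) :
    M.1.edge x = (finEdgeLabeling n).flip x := (M.2.1.1 x).1 (List.mem_finRange _)

theorem sides_eq (M : StandardOneFaceMap n) : M.1.sides = Set.univ :=
  EdgeLabeling.sides_eq_univ M.edge_eq

/-- The unlabeled map with the root `r`. -/
def toRooted (z : StandardOneFaceMap n × Fin (2 * n)) : RootedOneFaceMap n :=
  Quotient.mk _ ⟨z.1.1, z.2, z.1.sides_eq, z.1.2.2⟩

/-- By rigidity, distinct relabelings of a representative give distinct labeled rooted maps, so the
fiber is in bijection with the relabelings counted in `card_relabelings`. -/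
theorem card_fiber (κ : RootedOneFaceMap n) :
    (Nat.card {z : StandardOneFaceMap n × Fin (2 * n) // toRooted z = κ} : ℚ) =
      2 ^ n * n.factorial * κ.monTop := by
  induction κ using Quotient.ind with
  | _ M =>
  have hcard := (finEdgeLabeling n).card_relabelings (M := M.map) (List.nodup_finRange n)
    List.mem_finRange M.sides_eq
  rw [Nat.card_fin] at hcard
  change _ = _ * M.map.monTop
  rw [← hcard]
  congr 1
  have hiso : ∀ f : Perm (Fin (2 * n)), NonOrientedMap.IsIso f (M.map.conj f) M.map :=
    fun f => NonOrientedMap.isIso_iff_eq_conj.2 rfl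
  have hface : ∀ f : Perm (Fin (2 * n)), Nat.card (M.map.conj f).Face = 1 := fun f => by
    rw [Nat.card_congr (hiso f).faceEquiv, M.oneFace]
  symm
  refine Nat.card_eq_of_bijective (fun f => ⟨(⟨M.map.conj f.1, f.2, hface f.1⟩, f.1.symm M.root),
    Quotient.sound ⟨f.1, hiso f.1, f.1.apply_symm_apply _⟩⟩) ⟨?_, ?_⟩
  · rintro ⟨f, hf⟩ ⟨g, hg⟩ h
    have h1 : M.map.conj f = M.map.conj g := congrArg (fun z => z.1.1.1) h
    have h2 : f.symm M.root = g.symm M.root := congrArg (fun z => z.1.2) h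
    have : Nonempty (Fin (2 * n)) := ⟨M.root⟩
    refine Subtype.ext ((hiso f).eq_of_faceSetoid_eq_top (h1 ▸ hiso g) ?_ (x := f.symm M.root) ?_)
    · exact (NonOrientedMap.card_face_eq_one_iff ((hiso f).sides_eq_univ M.sides_eq)).1 (hface f)
    · rw [apply_symm_apply, h2, apply_symm_apply]
  · rintro ⟨⟨⟨N, hN⟩, r⟩, h⟩
    obtain ⟨f, hf, hr⟩ := Quotient.exact h
    obtain rfl := NonOrientedMap.isIso_iff_eq_conj.1 hf
    exact ⟨⟨f, hN.1⟩, Subtype.ext (Prod.ext rfl (f.symm_apply_eq.2 hr.symm))⟩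

open Classical in
theorem card_face_eq_one_iff (hn : 1 ≤ n) {M : NonOrientedMap (Fin (2 * n))}
    (hM : M ∈ (finEdgeLabeling n).topMaps (List.finRange n)) :
    Nat.card M.Face = 1 ↔ (finEdgeLabeling n).cornerSetoid M.black ⊔
      (finEdgeLabeling n).cornerSetoid M.white = ⊤ := by
  obtain ⟨hE, ht⟩ := EdgeLabeling.mem_topMaps _ |>.1 hM
  have : Nonempty (Fin (2 * n)) := ⟨⟨0, by omega⟩⟩
  have hrel := fun x y => hE.faceSetoid_iff ht.isTopDegree (x := x) (y := y)
    (List.mem_finRange _) (List.mem_finRange _)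
  rw [NonOrientedMap.card_face_eq_one_iff (EdgeLabeling.sides_eq_univ (Λ := finEdgeLabeling n)
    fun x => (hE x).1 (List.mem_finRange _))]
  constructor
  · intro h
    refine top_le_iff.1 fun y y' _ => ?_
    have h1 := (hrel ((finEdgeLabeling n).side y) ((finEdgeLabeling n).side y')).1
      (by rw [h]; trivial)
    rwa [EdgeLabeling.label_side, EdgeLabeling.label_side] at h1
  · intro h
    refine top_le_iff.1 fun x y _ => (hrel x y).2 ?_
    rw [h]
    trivial

-- Here `2 * n` counts the root sides. For the maps in the sum on the right, having one face is the
-- same as being connected, which is the condition on the join.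
open Classical in
theorem sum_rootedOneFaceMap (hn : 1 ≤ n) (g : UnlabeledGraph → ℚ) :
    2 ^ n * n.factorial * ∑ κ : RootedOneFaceMap n, κ.monTop * g κ.graph =
      2 * n * ∑ M ∈ (finEdgeLabeling n).topMaps (List.finRange n),
        if (finEdgeLabeling n).cornerSetoid M.black ⊔
          (finEdgeLabeling n).cornerSetoid M.white = ⊤ then
          g (Quotient.mk _ (setoidGraph ((finEdgeLabeling n).cornerSetoid M.black)
            ((finEdgeLabeling n).cornerSetoid M.white)))
        else 0 := by
  let _ : Fintype (StandardOneFaceMap n) := Fintype.ofFinite _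
  have h1 := sum_fiber_card (toRooted (n := n)) fun κ : RootedOneFaceMap n => g κ.graph
  simp_rw [card_fiber, mul_assoc] at h1
  simp_rw [mul_assoc]
  rw [Finset.mul_sum, Finset.mul_sum]
  refine h1.symm.trans ?_
  have hgraph : ∀ M : StandardOneFaceMap n, ∀ r, (toRooted (M, r)).graph =
      Quotient.mk _ (setoidGraph ((finEdgeLabeling n).cornerSetoid M.1.black)
            ((finEdgeLabeling n).cornerSetoid M.1.white)) := fun M r =>
    Quotient.sound ((finEdgeLabeling n).graph_isomorphic_setoidGraph M.edge_eq)
  rw [Fintype.sum_prod_type]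
  simp_rw [hgraph, Finset.sum_const, Finset.card_univ, Fintype.card_fin, nsmul_eq_mul]
  rw [← Finset.mul_sum, ← Finset.sum_filter, Nat.cast_mul, Nat.cast_ofNat, mul_assoc]
  congr 2
  refine Finset.sum_bij (fun M _ => M.1) ?_ ?_ ?_ ?_
  · intro M _
    have hM := (EdgeLabeling.mem_topMaps _).2 M.2.1
    exact Finset.mem_filter.2 ⟨hM, (card_face_eq_one_iff hn hM).1 M.2.2⟩
  · exact fun M _ N _ h => Subtype.ext h
  · intro M hM
    obtain ⟨hM, hc⟩ := Finset.mem_filter.1 hM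
    exact ⟨⟨M, (EdgeLabeling.mem_topMaps _).1 hM, (card_face_eq_one_iff hn hM).2 hc⟩,
      Finset.mem_univ _, rfl⟩
  · exact fun M _ => rfl

end StandardOneFaceMap

end OneFace

theorem theorem0p1 (n : ℕ) (hn : 1 ≤ n) :
    (∑ M₁ : RootedOrientedMap n, Finsupp.single M₁.graph 1 : UnlabeledGraph →₀ ℚ) =
      ∑ M₂ : RootedOneFaceMap n, Finsupp.single M₂.graph M₂.monTop := by
  classical
  ext Γ
  rw [Finsupp.finsetSum_apply, Finsupp.finsetSum_apply]
  -- Equality of formal sums is tested coefficientwise, with the indicator of one graph as weight.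
  let g : UnlabeledGraph → ℚ := fun G => if G = Γ then 1 else 0
  have hL : ∀ κ : RootedOrientedMap n,
      (Finsupp.single κ.graph 1 : UnlabeledGraph →₀ ℚ) Γ = g κ.graph := fun κ => by
    simp only [Finsupp.single_apply, g]
  have hR : ∀ κ : RootedOneFaceMap n,
      (Finsupp.single κ.graph κ.monTop : UnlabeledGraph →₀ ℚ) Γ = κ.monTop * g κ.graph :=
    fun κ => by simp only [Finsupp.single_apply, g, mul_ite, mul_one, mul_zero]
  simp_rw [hL, hR]
  have h1 := sum_rootedOrientedMap n g
  have h2 := StandardOneFaceMap.sum_rootedOneFaceMap hn g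
  have h3 := (finEdgeLabeling n).sum_perms_eq_sum_topMaps (List.nodup_finRange n) fun P Q =>
    if P ⊔ Q = ⊤ then g (Quotient.mk _ (setoidGraph P Q)) else 0
  have hperms : permsOn (List.finRange n) = Finset.univ := by
    ext σ
    simp [mem_permsOn]
  have htop : Nat.card (Quotient (⊤ : Setoid (Fin n))) = 1 :=
    Nat.card_eq_one_iff_unique.2 ⟨⟨by rintro ⟨x⟩ ⟨y⟩; exact Quotient.sound trivial⟩,
      ⟨Quotient.mk _ ⟨0, hn⟩⟩⟩
  -- Only connected pairs survive, and these have a single class, so the power of 1/2 is the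
  -- constant 1/2.
  have hhalf : ∀ P Q : Setoid (Fin n), (1 / 2 : ℚ) ^ Nat.card (Quotient (P ⊔ Q)) *
      (if P ⊔ Q = ⊤ then g (Quotient.mk _ (setoidGraph P Q)) else 0) =
      1 / 2 * if P ⊔ Q = ⊤ then g (Quotient.mk _ (setoidGraph P Q)) else 0 := by
    intro P Q
    split_ifs with h
    · rw [h, htop, pow_one]
    · simp
  simp_rw [hperms, hhalf, ← Finset.mul_sum] at h3
  rw [Nat.card_fin] at h3
  have hf : (n.factorial : ℚ) ≠ 0 := by exact_mod_cast Nat.factorial_ne_zero n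
  have hp : (2 ^ n : ℚ) ≠ 0 := by positivity
  -- After scaling by `2 ^ n * n!`, the left side is `2 ^ n * n` times the permutation sum and the
  -- right side `2 * n` times the map sum; the comparison identity says that the map sum is `2 ^ n /
  -- 2` times the permutation sum.
  refine mul_left_cancel₀ (mul_ne_zero hp hf) ?_
  rw [h2, mul_assoc, h1]
  rw [one_div, inv_pow, inv_mul_eq_iff_eq_mul₀ two_ne_zero] at h3
  rw [h3]
  field_simp
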